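/- Let $n\ge 1$. For an integer $0\le i<2^n$ let $[i]_k\in\{0,1\}$ denote its $k$-th binary digit, let $\mathrm{par}_k(i)=\sum_{\ell=0}^{k}[i]_\ell \bmod 2$, and let $i\#k$ be the number obtained from $i$ by flipping its $k$-th binary digit ($k<n$). The hypercube $Q_n$ is the bipartite graph with vertex classes $U_n=\{i<2^n : \mathrm{par}_{n-1}(i)=0\}$ and $V_n=\{j<2^n : \mathrm{par}_{n-1}(j)=1\}$, in which $i\in U_n$ and $j\in V_n$ are joined by an edge $ij$ if and only if $j=i\#k$ for some $k<n$. Let $C^*(Q_n)$ be the universal unital $C^*$-algebra generated by projections $(p_x)_{x\in U_n\cup V_n}$ subject to the relations $\sum_{i\in U_n}p_i=1=\sum_{j\in V_n}p_j$ and $p_ip_j=0$ whenever $i\in U_n$, $j\in V_n$ are not joined by an edge. For $\mathbf t=(t_0,\dots,t_{n-1})$ in the standard simplex $\Delta_{n-1}=\{\mathbf t\in[0,1]^n : \sum_k t_k=1\}$ put $c_{\mathbf t}(ij)=(-1)^{\mathrm{par}_k(i)}\sqrt{t_k}$ if $i\in U_n$, $j=i\#k\in V_n$, and $c_{\mathbf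 t}(ij)=0$ if $i\in U_n$, $j\in V_n$ are not joined by an edge. Let $\rho_{\mathbf t}:C^*(Q_n)\to B(\mathbb C^{U_n})$ be the unique representation with $\rho_{\mathbf t}(p_i)=E_{ii}$ for $i\in U_n$ and $\rho_{\mathbf t}(p_j)=\big[c_{\mathbf t}(i_1j)\,\overline{c_{\mathbf t}(i_2j)}\big]_{i_1,i_2\in U_n}$ for $j\in V_n$. Then for every irreducible representation $\rho:C^*(Q_n)\to B(\mathcal H)$ on a Hilbert space $\mathcal H$ there is a point $\mathbf t\in\Delta_{n-1}$ such that $\rho$ is unitarily equivalent to a subrepresentation of $\rho_{\mathbf t}$, i.e. to the restriction of $\rho_{\mathbf t}$ to a subspace $W\subseteq\mathbb C^{U_n}$ such that $W$ and $W^\perp$ are both invariant under $\rho_{\mathbf t}$. -/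

import Mathlib

namespace HypercubeAlgebra

/-! ### The free unital star-algebra on a set of self-adjoint generators -/

/-- The free unital complex star-algebra on a family of self-adjoint generators indexed by `X`:
the monoid algebra of words in `X`. -/
def FreeStarAlg (X : Type*) : Type _ := MonoidAlgebra ℂ (FreeMonoid X)

namespace FreeStarAlg

variable {X : Type*}

noncomputable instance : Ring (FreeStarAlg X) :=
  inferInstanceAs (Ring (MonoidAlgebra ℂ (FreeMonoid X)))

noncomputable instance : Algebra ℂ (FreeStarAlg X) :=
  inferInstanceAs (Algebra ℂ (MonoidAlgebra ℂ (FreeMonoid X)))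

/-- The scalar multiple `c • w` of a word `w`. -/
noncomputable def word (w : FreeMonoid X) (c : ℂ) : FreeStarAlg X :=
  (MonoidAlgebra.single w c : MonoidAlgebra ℂ (FreeMonoid X))

/-- The generator with index `x`. -/
noncomputable def gen (x : X) : FreeStarAlg X := word (FreeMonoid.of x) 1

lemma word_mul (v w : FreeMonoid X) (a b : ℂ) : word v a * word w b = word (v * w) (a * b) :=
  MonoidAlgebra.single_mul_single v w a b

lemma word_one : word (1 : FreeMonoid X) 1 = 1 := rfl

lemma smul_word (w : FreeMonoid X) (a b : ℂ) : a • word w b = word w (a * b) :=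
  MonoidAlgebra.smul_single a w b

lemma word_induction {P : FreeStarAlg X → Prop} (a : FreeStarAlg X)
    (hw : ∀ w c, P (word w c)) (hadd : ∀ a b, P a → P b → P (a + b)) : P a := by
  have h0 : P 0 := by
    have := hw 1 0
    rwa [show word (1 : FreeMonoid X) 0 = 0 from MonoidAlgebra.single_zero _] at this
  exact MonoidAlgebra.induction_linear (motive := P) a h0 hadd hw

/-- The conjugate-linear anti-automorphism reversing words, as a map to the opposite algebra. -/
noncomputable def starHom : FreeStarAlg X →+* (FreeStarAlg X)ᵐᵒᵖ :=
  MonoidAlgebra.liftNCRingHom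
    ((algebraMap ℂ (FreeStarAlg X)ᵐᵒᵖ).comp (starRingEnd ℂ))
    (FreeMonoid.lift fun x => MulOpposite.op (gen x))
    (fun c _ => Algebra.commute_algebraMap_left (starRingEnd ℂ c) _)

lemma lift_op_gen (w : FreeMonoid X) :
    FreeMonoid.lift (fun x : X => MulOpposite.op (gen x)) w
      = MulOpposite.op (word (star w) 1) := by
  induction w using FreeMonoid.inductionOn' with
  | one => rfl
  | of_mul x w ih =>
    rw [map_mul, ih, FreeMonoid.lift_eval_of, ← MulOpposite.op_mul, gen, word_mul, star_mul,
      FreeMonoid.star_of, one_mul]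

lemma starHom_word (w : FreeMonoid X) (c : ℂ) :
    starHom (word w c) = MulOpposite.op (word (star w) (star c)) := by
  have : starHom (word w c) = algebraMap ℂ (FreeStarAlg X)ᵐᵒᵖ (star c) *
      FreeMonoid.lift (fun x : X => MulOpposite.op (gen x)) w :=
    MonoidAlgebra.liftNCRingHom_single _ _ _ _ _
  rw [this, lift_op_gen, ← Algebra.smul_def, ← MulOpposite.op_smul, smul_word, mul_one]

/-- The involution: the conjugate-linear extension of word reversal. -/
noncomputable instance : StarRing (FreeStarAlg X) where
  star a := (starHom a).unop
  star_involutive a := by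
    induction a using word_induction with
    | hw w c => simp [starHom_word]
    | hadd a b ha hb => simp only [map_add, MulOpposite.unop_add, ha, hb]
  star_mul a b := by simp
  star_add a b := by simp

lemma star_word (w : FreeMonoid X) (c : ℂ) : star (word w c) = word (star w) (star c) :=
  congrArg MulOpposite.unop (starHom_word w c)

@[simp] lemma star_gen (x : X) : star (gen x) = gen x := by
  simp [gen, star_word]

instance : StarModule ℂ (FreeStarAlg X) where
  star_smul c a := by
    induction a using word_induction with
    | hw w b => simp [smul_word, star_word]
    | hadd a b ha hb => simp only [smul_add, star_add, ha, hb]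

lemma gen_induction {P : FreeStarAlg X → Prop} (a : FreeStarAlg X)
    (h1 : P 1) (hgen : ∀ x a, P a → P (gen x * a)) (hsmul : ∀ (c : ℂ) a, P a → P (c • a))
    (hadd : ∀ a b, P a → P b → P (a + b)) : P a := by
  induction a using word_induction with
  | hadd a b ha hb => exact hadd a b ha hb
  | hw w c =>
    rw [← mul_one c, ← smul_word]
    apply hsmul
    induction w using FreeMonoid.inductionOn' with
    | one => exact h1
    | of_mul x w ih => simpa [gen, word_mul] using hgen x _ ih

/-- The star-homomorphism determined by a family of self-adjoint elements. -/
noncomputable def lift {B : Type*} [Ring B] [StarRing B] [Algebra ℂ B] [StarModule ℂ B]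
    (p : X → B) (hp : ∀ x, IsSelfAdjoint (p x)) : FreeStarAlg X →⋆ₐ[ℂ] B :=
  let φ : FreeStarAlg X →ₐ[ℂ] B := MonoidAlgebra.lift ℂ B (FreeMonoid X) (FreeMonoid.lift p)
  have hφ (w : FreeMonoid X) (c : ℂ) : φ (word w c) = c • FreeMonoid.lift p w :=
    MonoidAlgebra.lift_single _ _ _
  { φ with
    map_star' := fun a => by
      change φ (star a) = star (φ a)
      induction a using word_induction with
      | hadd a b ha hb => simp only [star_add, map_add, ha, hb]
      | hw w c =>
        rw [star_word, hφ, hφ, star_smul]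
        congr 1
        induction w using FreeMonoid.inductionOn' with
        | one => simp
        | of_mul x w ih => simp [ih, (hp x).star_eq] }

@[simp] lemma lift_gen {B : Type*} [Ring B] [StarRing B] [Algebra ℂ B] [StarModule ℂ B]
    (p : X → B) (hp : ∀ x, IsSelfAdjoint (p x)) (x : X) : lift p hp (gen x) = p x := by
  refine (MonoidAlgebra.lift_single 
    (FreeMonoid.lift p) (FreeMonoid.of x) (1 : ℂ)).trans ?_
  simp

end FreeStarAlg


/-! ### Bipartite graphs and their C*-algebras -/

/-- A bipartite graph with vertex classes `U` and `V`; `G.Adj u v` says that `{u, v}` is an edge. -/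
structure BipartiteGraph (U V : Type*) where
  Adj : U → V → Prop

section GraphAlgebra

variable {U V : Type*} [Fintype U] [Fintype V]

/-- A family of projections indexed by the vertices of `G` satisfying the defining relations of
the C*-algebra of `G`. -/
structure IsGraphFamily (G : BipartiteGraph U V) {B : Type*} [Ring B] [StarRing B]
    (p : U ⊕ V → B) : Prop where
  proj : ∀ x, IsStarProjection (p x)
  sum_left : ∑ u, p (.inl u) = 1
  sum_right : ∑ v, p (.inr v) = 1
  orth : ∀ u v, ¬ G.Adj u v → p (.inl u) * p (.inr v) = 0

/-- The elements of the free star-algebra that the defining relations of `C*(G)` send to zero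
(the generators are self-adjoint already in the free star-algebra). -/
inductive Relator (G : BipartiteGraph U V) : FreeStarAlg (U ⊕ V) → Prop
  | idem (x : U ⊕ V) : Relator G (FreeStarAlg.gen x * FreeStarAlg.gen x - FreeStarAlg.gen x)
  | sum_left : Relator G (∑ u, FreeStarAlg.gen (.inl u) - 1)
  | sum_right : Relator G (∑ v, FreeStarAlg.gen (.inr v) - 1)
  | orth (u : U) (v : V) (h : ¬ G.Adj u v) :
      Relator G (FreeStarAlg.gen (.inl u) * FreeStarAlg.gen (.inr v))

/-- A C*-seminorm on the free star-algebra that vanishes on the relators of `G`. -/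
structure GraphSeminorm (G : BipartiteGraph U V) extends Seminorm ℂ (FreeStarAlg (U ⊕ V)) where
  mul_le : ∀ a b, toFun (a * b) ≤ toFun a * toFun b
  cstar : ∀ a, toFun (star a * a) = toFun a * toFun a
  relator : ∀ r, Relator G r → toFun r = 0

namespace GraphSeminorm

variable {G : BipartiteGraph U V}

instance : Nonempty (GraphSeminorm G) :=
  ⟨{ (0 : Seminorm ℂ (FreeStarAlg (U ⊕ V))) with
      mul_le := fun _ _ => (mul_zero (0 : ℝ)).ge
      cstar := fun _ => (mul_zero (0 : ℝ)).symm
      relator := fun _ _ => rfl }⟩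

lemma nonneg (q : GraphSeminorm G) (a : FreeStarAlg (U ⊕ V)) : 0 ≤ q.toSeminorm a :=
  apply_nonneg q.toSeminorm a

lemma map_one_le (q : GraphSeminorm G) : q.toSeminorm 1 ≤ 1 := by
  have h : q.toSeminorm 1 = q.toSeminorm 1 * q.toSeminorm 1 := by
    have := q.cstar 1
    rwa [star_one, one_mul] at this
  nlinarith [q.nonneg 1]

lemma map_gen_le (q : GraphSeminorm G) (x : U ⊕ V) : q.toSeminorm (FreeStarAlg.gen x) ≤ 1 := by
  have h1 : q.toSeminorm (FreeStarAlg.gen x * FreeStarAlg.gen x)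
      = q.toSeminorm (FreeStarAlg.gen x) * q.toSeminorm (FreeStarAlg.gen x) := by
    have := q.cstar (FreeStarAlg.gen x)
    rwa [FreeStarAlg.star_gen] at this
  have h2 : q.toSeminorm (FreeStarAlg.gen x * FreeStarAlg.gen x - FreeStarAlg.gen x) = 0 :=
    q.relator _ (Relator.idem x)
  have h3 := map_add_le_add q.toSeminorm
    (FreeStarAlg.gen x * FreeStarAlg.gen x - FreeStarAlg.gen x) (FreeStarAlg.gen x)
  rw [sub_add_cancel, h1, h2] at h3
  nlinarith [q.nonneg (FreeStarAlg.gen x)]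

lemma bddAbove (a : FreeStarAlg (U ⊕ V)) :
    BddAbove (Set.range fun q : GraphSeminorm G => q.toSeminorm a) := by
  suffices h : ∃ C : ℝ, ∀ q : GraphSeminorm G, q.toSeminorm a ≤ C by
    obtain ⟨C, hC⟩ := h
    exact ⟨C, by rintro _ ⟨q, rfl⟩; exact hC q⟩
  induction a using FreeStarAlg.gen_induction with
  | h1 => exact ⟨1, map_one_le⟩
  | hgen x a ih =>
    obtain ⟨C, hC⟩ := ih
    refine ⟨C, fun q => (q.mul_le _ _).trans ?_⟩
    have h1 := q.map_gen_le x
    have h2 := hC q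
    have h3 := q.nonneg a
    have h4 := q.nonneg (FreeStarAlg.gen x)
    change q.toSeminorm (FreeStarAlg.gen x) * q.toSeminorm a ≤ C
    nlinarith
  | hsmul c a ih =>
    obtain ⟨C, hC⟩ := ih
    refine ⟨‖c‖ * C, fun q => ?_⟩
    rw [map_smul_eq_mul]
    exact mul_le_mul_of_nonneg_left (hC q) (norm_nonneg c)
  | hadd a b iha ihb =>
    obtain ⟨C, hC⟩ := iha
    obtain ⟨D, hD⟩ := ihb
    exact ⟨C + D, fun q => (map_add_le_add q.toSeminorm a b).trans (add_le_add (hC q) (hD q))⟩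

end GraphSeminorm

/-- The universal C*-seminorm: the largest C*-seminorm vanishing on the relators of `G`. -/
noncomputable def univNorm (G : BipartiteGraph U V) (a : FreeStarAlg (U ⊕ V)) : ℝ :=
  ⨆ q : GraphSeminorm G, q.toSeminorm a

section univNorm

variable (G : BipartiteGraph U V)

lemma le_univNorm (q : GraphSeminorm G) (a : FreeStarAlg (U ⊕ V)) :
    q.toSeminorm a ≤ univNorm G a :=
  le_ciSup (GraphSeminorm.bddAbove a) q

lemma univNorm_le {a : FreeStarAlg (U ⊕ V)} {C : ℝ}
    (h : ∀ q : GraphSeminorm G, q.toSeminorm a ≤ C) : univNorm G a ≤ C := ciSup_le h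

lemma univNorm_nonneg (a : FreeStarAlg (U ⊕ V)) : 0 ≤ univNorm G a :=
  Real.iSup_nonneg fun q => q.nonneg a

lemma univNorm_mul (a b : FreeStarAlg (U ⊕ V)) :
    univNorm G (a * b) ≤ univNorm G a * univNorm G b :=
  univNorm_le G fun q => (q.mul_le a b).trans
    (mul_le_mul (le_univNorm G q a) (le_univNorm G q b) (q.nonneg b) (univNorm_nonneg G a))

lemma univNorm_cstar (a : FreeStarAlg (U ⊕ V)) :
    univNorm G (star a * a) = univNorm G a * univNorm G a := by
  apply le_antisymm
  · refine univNorm_le G fun q => (q.cstar a).trans_le ?_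
    exact mul_le_mul (le_univNorm G q a) (le_univNorm G q a) (q.nonneg a) (univNorm_nonneg G a)
  · have h : univNorm G a ≤ √(univNorm G (star a * a)) := by
      refine univNorm_le G fun q => Real.le_sqrt_of_sq_le ?_
      rw [pow_two]
      exact (q.cstar a).symm.trans_le (le_univNorm G q (star a * a))
    calc univNorm G a * univNorm G a
        ≤ √(univNorm G (star a * a)) * √(univNorm G (star a * a)) :=
          mul_le_mul h h (univNorm_nonneg G a) (Real.sqrt_nonneg _)
      _ = univNorm G (star a * a) := Real.mul_self_sqrt (univNorm_nonneg G _)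

lemma univNorm_add (a b : FreeStarAlg (U ⊕ V)) :
    univNorm G (a + b) ≤ univNorm G a + univNorm G b :=
  univNorm_le G fun q => (map_add_le_add q.toSeminorm a b).trans
    (add_le_add (le_univNorm G q a) (le_univNorm G q b))

lemma univNorm_smul (c : ℂ) (a : FreeStarAlg (U ⊕ V)) :
    univNorm G (c • a) = ‖c‖ * univNorm G a := by
  unfold univNorm
  rw [Real.mul_iSup_of_nonneg (norm_nonneg c)]
  exact iSup_congr fun q => map_smul_eq_mul q.toSeminorm c a

lemma univNorm_neg (a : FreeStarAlg (U ⊕ V)) : univNorm G (-a) = univNorm G a := by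
  have := univNorm_smul G (-1) a
  rwa [neg_one_smul, norm_neg, norm_one, one_mul] at this

lemma univNorm_relator {r : FreeStarAlg (U ⊕ V)} (hr : Relator G r) : univNorm G r = 0 := by
  unfold univNorm
  have : ∀ q : GraphSeminorm G, q.toSeminorm r = 0 := fun q => q.relator r hr
  simp [this]

end univNorm

/-- The free star-algebra on the vertices of `G`, equipped with the universal C*-seminorm. -/
def PreAlg (_G : BipartiteGraph U V) : Type _ := FreeStarAlg (U ⊕ V)

section PreAlg

variable (G : BipartiteGraph U V)

noncomputable instance : Ring (PreAlg G) := inferInstanceAs (Ring (FreeStarAlg (U ⊕ V)))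
noncomputable instance : Algebra ℂ (PreAlg G) :=
  inferInstanceAs (Algebra ℂ (FreeStarAlg (U ⊕ V)))
noncomputable instance : StarRing (PreAlg G) := inferInstanceAs (StarRing (FreeStarAlg (U ⊕ V)))
instance : StarModule ℂ (PreAlg G) := inferInstanceAs (StarModule ℂ (FreeStarAlg (U ⊕ V)))

noncomputable instance : SeminormedRing (PreAlg G) :=
  RingSeminorm.toSeminormedRing (R := PreAlg G)
    { toFun := univNorm G
      map_zero' := by
        have := univNorm_smul G 0 0
        rwa [zero_smul, norm_zero, zero_mul] at this
      add_le' := univNorm_add G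
      neg' := univNorm_neg G
      mul_le' := univNorm_mul G }

lemma PreAlg.norm_def (a : PreAlg G) : ‖a‖ = univNorm G a := rfl

noncomputable instance : NormedAlgebra ℂ (PreAlg G) where
  norm_smul_le c a := (univNorm_smul G c a).le

lemma PreAlg.norm_star_mul_self (a : PreAlg G) : ‖star a * a‖ = ‖a‖ * ‖a‖ := univNorm_cstar G a

lemma PreAlg.norm_star_le (a : PreAlg G) : ‖a‖ ≤ ‖star a‖ := by
  by_contra! h
  have h1 := PreAlg.norm_star_mul_self G a
  have h2 := norm_mul_le (star a) a
  have h3 := norm_nonneg (star a)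
  nlinarith

lemma PreAlg.norm_star (a : PreAlg G) : ‖star a‖ = ‖a‖ :=
  le_antisymm (by simpa using PreAlg.norm_star_le G (star a)) (PreAlg.norm_star_le G a)

instance : NormedStarGroup (PreAlg G) where
  norm_star_le a := (PreAlg.norm_star G a).le

end PreAlg

/-- The universal C*-algebra `C*(G)` of the bipartite graph `G`: the Hausdorff completion of the
free star-algebra on the vertices with respect to the largest C*-seminorm that respects the
relations. -/
def CStarAlg (G : BipartiteGraph U V) : Type _ := UniformSpace.Completion (PreAlg G)

namespace CStarAlg

open UniformSpace (Completion)

variable (G : BipartiteGraph U V)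

noncomputable instance : NormedRing (CStarAlg G) :=
  inferInstanceAs (NormedRing (Completion (PreAlg G)))

instance : CompleteSpace (CStarAlg G) := inferInstanceAs (CompleteSpace (Completion (PreAlg G)))

noncomputable instance : NormedAlgebra ℂ (CStarAlg G) :=
  { (inferInstanceAs (Algebra ℂ (Completion (PreAlg G))) : Algebra ℂ (CStarAlg G)) with
    norm_smul_le := fun c a => by
      refine (norm_smul_le c (show Completion (PreAlg G) from a)) }

/-- The canonical map from the free star-algebra. -/
noncomputable def mk (a : FreeStarAlg (U ⊕ V)) : CStarAlg G :=
  ((show PreAlg G from a : PreAlg G) : Completion (PreAlg G))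

variable {G} in
lemma mk_induction {P : CStarAlg G → Prop} (a : CStarAlg G) (hc : IsClosed {a | P a})
    (h : ∀ a, P (mk G a)) : P a :=
  Completion.induction_on (α := PreAlg G) a hc h

lemma mk_add (a b : FreeStarAlg (U ⊕ V)) : mk G (a + b) = mk G a + mk G b :=
  Completion.coe_add (α := PreAlg G) a b

lemma mk_mul (a b : FreeStarAlg (U ⊕ V)) : mk G (a * b) = mk G a * mk G b :=
  Completion.coe_mul (α := PreAlg G) a b

lemma mk_sub (a b : FreeStarAlg (U ⊕ V)) : mk G (a - b) = mk G a - mk G b :=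
  Completion.coe_sub (α := PreAlg G) a b

lemma mk_one : mk G 1 = 1 := rfl

lemma mk_smul (c : ℂ) (a : FreeStarAlg (U ⊕ V)) : mk G (c • a) = c • mk G a :=
  Completion.coe_smul (M := ℂ) (X := PreAlg G) c a

lemma norm_mk (a : FreeStarAlg (U ⊕ V)) : ‖mk G a‖ = univNorm G a :=
  Completion.norm_coe (E := PreAlg G) a

lemma mk_sum {ι : Type*} (s : Finset ι) (f : ι → FreeStarAlg (U ⊕ V)) :
    mk G (∑ i ∈ s, f i) = ∑ i ∈ s, mk G (f i) :=
  map_sum (AddMonoidHom.mk' (mk G) (mk_add G)) f s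

/-- The involution, extended by continuity. -/
noncomputable instance : Star (CStarAlg G) where
  star := Completion.map (star : PreAlg G → PreAlg G)

lemma continuous_star' : Continuous (star : CStarAlg G → CStarAlg G) :=
  Completion.continuous_map

lemma star_mk (a : FreeStarAlg (U ⊕ V)) : star (mk G a) = mk G (star a) :=
  Completion.map_coe (α := PreAlg G)
    (AddMonoidHomClass.uniformContinuous_of_bound (starAddEquiv : PreAlg G ≃+ PreAlg G) 1
      fun a => by simp) a

noncomputable instance : StarRing (CStarAlg G) where
  star_involutive a := by
    induction a using mk_induction with
    | hc => exact isClosed_eq ((continuous_star' G).comp (continuous_star' G)) continuous_id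
    | h a => rw [star_mk, star_mk, star_star]
  star_mul a b := by
    induction a using mk_induction with
    | hc =>
      exact isClosed_eq ((continuous_star' G).comp (continuous_id.mul continuous_const))
        (continuous_const.mul (continuous_star' G))
    | h a =>
      induction b using mk_induction with
      | hc =>
        exact isClosed_eq ((continuous_star' G).comp (continuous_const.mul continuous_id))
          ((continuous_star' G).mul continuous_const)
      | h b => rw [← mk_mul, star_mk, star_mk, star_mk, star_mul, mk_mul]
  star_add a b := by
    induction a using mk_induction with
    | hc =>
      exact isClosed_eq ((continuous_star' G).comp (continuous_id.add continuous_const))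
        ((continuous_star' G).add continuous_const)
    | h a =>
      induction b using mk_induction with
      | hc =>
        exact isClosed_eq ((continuous_star' G).comp (continuous_const.add continuous_id))
          (continuous_const.add (continuous_star' G))
      | h b => rw [← mk_add, star_mk, star_mk, star_mk, star_add, mk_add]

instance : StarModule ℂ (CStarAlg G) where
  star_smul c a := by
    induction a using mk_induction with
    | hc =>
      exact isClosed_eq ((continuous_star' G).comp (continuous_id.const_smul c))
        ((continuous_star' G).const_smul (star c))
    | h a => rw [← mk_smul, star_mk, star_mk, star_smul, mk_smul]

instance : CStarRing (CStarAlg G) where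
  norm_mul_self_le a := by
    induction a using mk_induction with
    | hc =>
      exact isClosed_le (continuous_norm.mul continuous_norm)
        (continuous_norm.comp ((continuous_star' G).mul continuous_id))
    | h a => rw [star_mk, ← mk_mul, norm_mk, norm_mk, univNorm_cstar]

noncomputable instance : CStarAlgebra (CStarAlg G) where

/-- The canonical generating projections `p_x`, for `x` a vertex of `G`. -/
noncomputable def p (x : U ⊕ V) : CStarAlg G := mk G (FreeStarAlg.gen x)

lemma mk_relator {r : FreeStarAlg (U ⊕ V)} (hr : Relator G r) : mk G r = 0 := by
  rw [← norm_eq_zero, norm_mk, univNorm_relator G hr]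

/-- The canonical generators satisfy the defining relations. -/
theorem isGraphFamily_p : IsGraphFamily G (p G) where
  proj x :=
    { isIdempotentElem := by
        have := mk_relator G (Relator.idem x)
        rwa [mk_sub, mk_mul, sub_eq_zero] at this
      isSelfAdjoint := by
        change star (mk G _) = mk G _
        rw [star_mk, FreeStarAlg.star_gen] }
  sum_left := by
    have := mk_relator G Relator.sum_left
    rwa [mk_sub, mk_sum, mk_one, sub_eq_zero] at this
  sum_right := by
    have := mk_relator G Relator.sum_right
    rwa [mk_sub, mk_sum, mk_one, sub_eq_zero] at this
  orth u v h := by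
    have := mk_relator G (Relator.orth u v h)
    rwa [mk_mul] at this

section lift

variable {G} {B : Type*} [CStarAlgebra B] {x : U ⊕ V → B} (hx : IsGraphFamily G x)

/-- The C*-seminorm induced by a family of projections satisfying the relations. -/
noncomputable def familySeminorm : GraphSeminorm G :=
  let φ := FreeStarAlg.lift x fun y => (hx.proj y).isSelfAdjoint
  { (normSeminorm ℂ B).comp φ.toAlgHom.toLinearMap with
    mul_le := fun a b => by
      change ‖φ (a * b)‖ ≤ ‖φ a‖ * ‖φ b‖
      rw [map_mul]
      exact norm_mul_le _ _
    cstar := fun a => by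
      change ‖φ (star a * a)‖
        = ‖φ a‖ * ‖φ a‖
      rw [map_mul, map_star, CStarRing.norm_star_mul_self]
    relator := fun r hr => by
      change ‖φ r‖ = 0
      rw [norm_eq_zero]
      cases hr with
      | idem y => simp [φ, (hx.proj y).isIdempotentElem.eq]
      | sum_left => simp [φ, hx.sum_left]
      | sum_right => simp [φ, hx.sum_right]
      | orth u v h => simp [φ, hx.orth u v h] }

lemma norm_lift_le (a : FreeStarAlg (U ⊕ V)) :
    ‖FreeStarAlg.lift x (fun y => (hx.proj y).isSelfAdjoint) a‖ ≤ univNorm G a :=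
  le_univNorm G (familySeminorm hx) a

lemma uniformContinuous_lift : UniformContinuous
    (fun a : PreAlg G => FreeStarAlg.lift x (fun y => (hx.proj y).isSelfAdjoint) a) :=
  AddMonoidHomClass.uniformContinuous_of_bound
    (show PreAlg G →+ B from
      (FreeStarAlg.lift x fun y => (hx.proj y).isSelfAdjoint : FreeStarAlg (U ⊕ V) →+ B)) 1
    fun a => by
      rw [one_mul]
      exact norm_lift_le hx a

/-- The underlying function of `CStarAlg.lift`. -/
noncomputable def liftFun : CStarAlg G → B :=
  Completion.extension
    (fun a : PreAlg G => FreeStarAlg.lift x (fun y => (hx.proj y).isSelfAdjoint) a)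

lemma continuous_liftFun : Continuous (liftFun hx) := Completion.continuous_extension

lemma liftFun_mk (a : FreeStarAlg (U ⊕ V)) :
    liftFun hx (mk G a) = FreeStarAlg.lift x (fun y => (hx.proj y).isSelfAdjoint) a :=
  Completion.extension_coe (uniformContinuous_lift hx) a

lemma liftFun_one : liftFun hx 1 = 1 := by rw [← mk_one, liftFun_mk, map_one]

lemma liftFun_add (a b : CStarAlg G) : liftFun hx (a + b) = liftFun hx a + liftFun hx b := by
  have hc := continuous_liftFun hx
  induction a using mk_induction with
  | hc =>
    exact isClosed_eq (hc.comp (continuous_id.add continuous_const)) (hc.add continuous_const)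
  | h a =>
    induction b using mk_induction with
    | hc =>
      exact isClosed_eq (hc.comp (continuous_const.add continuous_id)) (continuous_const.add hc)
    | h b => rw [← mk_add, liftFun_mk, liftFun_mk, liftFun_mk, map_add]

lemma liftFun_mul (a b : CStarAlg G) : liftFun hx (a * b) = liftFun hx a * liftFun hx b := by
  have hc := continuous_liftFun hx
  induction a using mk_induction with
  | hc =>
    exact isClosed_eq (hc.comp (continuous_id.mul continuous_const)) (hc.mul continuous_const)
  | h a =>
    induction b using mk_induction with
    | hc =>
      exact isClosed_eq (hc.comp (continuous_const.mul continuous_id)) (continuous_const.mul hc)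
    | h b => rw [← mk_mul, liftFun_mk, liftFun_mk, liftFun_mk, map_mul]

lemma liftFun_smul (c : ℂ) (a : CStarAlg G) : liftFun hx (c • a) = c • liftFun hx a := by
  have hc := continuous_liftFun hx
  induction a using mk_induction with
  | hc => exact isClosed_eq (hc.comp (continuous_id.const_smul c)) (hc.const_smul c)
  | h a => rw [← mk_smul, liftFun_mk, liftFun_mk, map_smul]

lemma liftFun_star (a : CStarAlg G) : liftFun hx (star a) = star (liftFun hx a) := by
  have hc := continuous_liftFun hx
  induction a using mk_induction with
  | hc => exact isClosed_eq (hc.comp (continuous_star' G)) hc.star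
  | h a => rw [star_mk, liftFun_mk, liftFun_mk, map_star]

/-- Universal property of `C*(G)`, existence: every family of projections in a unital C*-algebra
that satisfies the relations of `G` extends to a unital star-homomorphism on `C*(G)`. -/
noncomputable def lift : CStarAlg G →⋆ₐ[ℂ] B :=
  { AlgHom.ofLinearMap
      { toFun := liftFun hx
        map_add' := liftFun_add hx
        map_smul' := liftFun_smul hx } (liftFun_one hx) (liftFun_mul hx) with
    map_star' := liftFun_star hx }

@[simp] theorem lift_p (y : U ⊕ V) : lift hx (p G y) = x y :=
  (liftFun_mk hx _).trans (FreeStarAlg.lift_gen _ _ _)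

/-- Universal property of `C*(G)`, uniqueness. -/
theorem hom_ext {φ ψ : CStarAlg G →⋆ₐ[ℂ] B} (h : ∀ y, φ (p G y) = ψ (p G y)) : φ = ψ := by
  have hφ : Continuous φ :=
    AddMonoidHomClass.continuous_of_bound φ 1 fun a => by
      rw [one_mul]; exact NonUnitalStarAlgHom.norm_apply_le φ a
  have hψ : Continuous ψ :=
    AddMonoidHomClass.continuous_of_bound ψ 1 fun a => by
      rw [one_mul]; exact NonUnitalStarAlgHom.norm_apply_le ψ a
  ext a
  induction a using mk_induction with
  | hc => exact isClosed_eq hφ hψ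
  | h a =>
    induction a using FreeStarAlg.gen_induction with
    | h1 => rw [mk_one, map_one, map_one]
    | hgen y a ih => rw [mk_mul, map_mul, map_mul, ih]; congr 1; exact h y
    | hsmul c a ih => rw [mk_smul, map_smul, map_smul, ih]
    | hadd a b iha ihb => rw [mk_add, map_add, map_add, iha, ihb]

end lift

end CStarAlg

end GraphAlgebra

/-! ### Representations on Hilbert spaces -/

section Representations

variable {A : Type*} [CStarAlgebra A]
  {H : Type*} [NormedAddCommGroup H] [InnerProductSpace ℂ H] [CompleteSpace H]
  {K : Type*} [NormedAddCommGroup K] [InnerProductSpace ℂ K] [CompleteSpace K]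

/-- A representation is irreducible if it acts on a nonzero Hilbert space and its only closed
invariant subspaces are the trivial ones. -/
def IsIrreducible (ρ : A →⋆ₐ[ℂ] (H →L[ℂ] H)) : Prop :=
  Nontrivial H ∧ ∀ W : Submodule ℂ H, IsClosed (W : Set H) →
    (∀ a, ∀ v ∈ W, ρ a v ∈ W) → W = ⊥ ∨ W = ⊤

/-- Unitary equivalence: a surjective linear isometry intertwines the two representations. -/
def UnitarilyEquivalent (ρ : A →⋆ₐ[ℂ] (H →L[ℂ] H)) (σ : A →⋆ₐ[ℂ] (K →L[ℂ] K)) : Prop :=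
  ∃ T : H ≃ₗᵢ[ℂ] K, ∀ a v, T (ρ a v) = σ a (T v)

/-- The subspace `W` and its orthogonal complement are both invariant, so that the representation
is the direct sum of its restrictions to `W` and to the complement. -/
def IsReducing (σ : A →⋆ₐ[ℂ] (K →L[ℂ] K)) (W : Submodule ℂ K) : Prop :=
  ∀ a, (∀ v ∈ W, σ a v ∈ W) ∧ (∀ v ∈ Wᗮ, σ a v ∈ Wᗮ)

/-- The restriction of a representation to a closed reducing subspace. -/
noncomputable def subrep (σ : A →⋆ₐ[ℂ] (K →L[ℂ] K)) (W : Submodule ℂ K) [CompleteSpace W]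
    (hW : IsReducing σ W) : A →⋆ₐ[ℂ] (W →L[ℂ] W) where
  toFun a := (σ a ∘L W.subtypeL).codRestrict W fun v => (hW a).1 v v.2
  map_one' := by ext v; simp
  map_mul' a b := by
    ext v
    simp only [map_mul]
    rfl
  map_zero' := by ext v; simp
  map_add' a b := by
    ext v
    simp only [map_add]
    rfl
  commutes' c := by ext v; simp [Algebra.algebraMap_eq_smul_one]
  map_star' a := by
    rw [ContinuousLinearMap.star_eq_adjoint, ContinuousLinearMap.eq_adjoint_iff]
    intro v w
    simp only [Submodule.coe_inner]
    change inner ℂ (σ (star a) v) (w : K) = inner ℂ (v : K) (σ a w)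
    rw [map_star, ContinuousLinearMap.star_eq_adjoint, ContinuousLinearMap.adjoint_inner_left]

/-- `ρ` is unitarily equivalent to a subrepresentation of `σ`. -/
def EquivToSubrep (ρ : A →⋆ₐ[ℂ] (H →L[ℂ] H)) (σ : A →⋆ₐ[ℂ] (K →L[ℂ] K)) : Prop :=
  ∃ (W : Submodule ℂ K) (_ : CompleteSpace W) (hW : IsReducing σ W),
    UnitarilyEquivalent ρ (subrep σ W hW)

end Representations

/-! ### Hypercubes -/

/-- `par k i` is the sum modulo `2` of the binary digits of `i` in the positions `0, …, k`. -/
def par (k i : ℕ) : ℕ := (∑ l ∈ Finset.range (k + 1), (i.testBit l).toNat) % 2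

/-- `flipDigit i k` is `i` with its `k`-th binary digit flipped. -/
def flipDigit (i k : ℕ) : ℕ := i ^^^ 2 ^ k

/-- The vertices `i < 2 ^ n` of the `n`-cube of even parity. -/
abbrev EvenVertex (n : ℕ) : Type := {i : Fin (2 ^ n) // par (n - 1) i = 0}

/-- The vertices `j < 2 ^ n` of the `n`-cube of odd parity. -/
abbrev OddVertex (n : ℕ) : Type := {j : Fin (2 ^ n) // par (n - 1) j = 1}

/-- The hypercube `Q_n`, for `n ≥ 1`. -/
def hypercube (n : ℕ) : BipartiteGraph (EvenVertex n) (OddVertex n) where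
  Adj i j := ∃ k < n, flipDigit i.1 k = j.1

lemma testBit_flip (i k l : ℕ) : (flipDigit i k).testBit l = if l = k then !i.testBit l else i.testBit l := by
  unfold flipDigit
  rw [Nat.testBit_xor, Nat.testBit_two_pow]
  by_cases h : l = k
  · subst h; simp
  · simp [h, Ne.symm h]

lemma flip_flip (i k : ℕ) : flipDigit (flipDigit i k) k = i := by
  simp [flipDigit]

lemma flip_comm (i k l : ℕ) : flipDigit (flipDigit i k) l = flipDigit (flipDigit i l) k := by
  simp [flipDigit, Nat.xor_assoc, Nat.xor_comm (2 ^ k)]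

/-- Flipping a digit adds or subtracts the corresponding power of two. -/
lemma flip_eq (i k : ℕ) : flipDigit i k = if i.testBit k then i - 2 ^ k else i + 2 ^ k := by
  have hd : flipDigit i k / 2 ^ k = (i / 2 ^ k) ^^^ 1 := by
    rw [flipDigit, Nat.xor_div_two_pow, Nat.div_self (by positivity)]
  have hm : flipDigit i k % 2 ^ k = i % 2 ^ k := by
    rw [flipDigit, Nat.xor_mod_two_pow, Nat.mod_self, Nat.xor_zero]
  have h1 := Nat.div_add_mod (flipDigit i k) (2 ^ k)
  have h2 := Nat.div_add_mod i (2 ^ k)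
  rw [hd, hm] at h1
  rw [Nat.testBit_eq_decide_div_mod_eq]
  split_ifs with h
  · have h3 : i / 2 ^ k % 2 = 1 := of_decide_eq_true h
    have h4 : i / 2 ^ k = (i / 2 ^ k ^^^ 1) + 1 := by
      rw [Nat.xor_one_of_odd (Nat.odd_iff.2 h3)]
      exact (Nat.sub_add_cancel (Nat.odd_iff.2 h3).pos).symm
    rw [h4, Nat.mul_add] at h2
    omega
  · have h3 : i / 2 ^ k % 2 = 0 := by
      have := of_decide_eq_false (eq_false_of_ne_true h)
      omega
    have h4 : i / 2 ^ k ^^^ 1 = i / 2 ^ k + 1 := by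
      exact Nat.xor_one_of_even (Nat.even_iff.2 h3)
    rw [h4, Nat.mul_add] at h1
    omega

lemma flip_inj {i k l : ℕ} : flipDigit i k = flipDigit i l ↔ k = l := by
  refine ⟨fun h => ?_, fun h => h ▸ rfl⟩
  have : 2 ^ k = 2 ^ l := by
    have := congrArg (fun x => i ^^^ x) h
    simpa [flipDigit, ← Nat.xor_assoc] using this
  exact Nat.pow_right_injective le_rfl this

lemma flip_lt {i k n : ℕ} (hi : i < 2 ^ n) (hk : k < n) : flipDigit i k < 2 ^ n :=
  Nat.xor_lt_two_pow hi (Nat.pow_lt_pow_right (by norm_num) hk)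

lemma par_lt (k i : ℕ) : par k i < 2 := Nat.mod_lt _ (by norm_num)

lemma neg_one_pow_par (k i : ℕ) :
    (-1 : ℝ) ^ par k i = ∏ l ∈ Finset.range (k + 1), (-1 : ℝ) ^ (i.testBit l).toNat := by
  rw [par, ← neg_one_pow_eq_pow_mod_two, Finset.prod_pow_eq_pow_sum]

lemma neg_one_pow_par_flip (k i l : ℕ) :
    (-1 : ℝ) ^ par k (flipDigit i l) = if l ≤ k then -(-1 : ℝ) ^ par k i else (-1 : ℝ) ^ par k i := by
  rw [neg_one_pow_par, neg_one_pow_par]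
  split_ifs with h
  · have hl : l ∈ Finset.range (k + 1) := Finset.mem_range.2 (by omega)
    rw [← Finset.mul_prod_erase _ _ hl, ← Finset.mul_prod_erase (Finset.range (k + 1))
      (fun m => (-1 : ℝ) ^ (i.testBit m).toNat) hl, ← neg_mul]
    congr 1
    · rw [testBit_flip]
      cases i.testBit l <;> simp
    · refine Finset.prod_congr rfl fun m hm => ?_
      rw [testBit_flip, if_neg (Finset.ne_of_mem_erase hm)]
  · refine Finset.prod_congr rfl fun m hm => ?_
    rw [testBit_flip, if_neg]
    have := Finset.mem_range.1 hm
    omega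

lemma par_flip {n i k : ℕ} (hk : k < n) : par (n - 1) (flipDigit i k) = 1 - par (n - 1) i := by
  have h := neg_one_pow_par_flip (n - 1) i k
  rw [if_pos (by omega)] at h
  have h1 := par_lt (n - 1) i
  have h2 := par_lt (n - 1) (flipDigit i k)
  interval_cases h3 : par (n - 1) i <;> interval_cases h4 : par (n - 1) (flipDigit i k) <;>
    first | rfl | norm_num at h

/-- The neighbor of an even vertex in direction `k`. -/
def EvenVertex.nbr {n : ℕ} (i : EvenVertex n) (k : Fin n) : OddVertex n :=
  ⟨⟨flipDigit i.1 k, flip_lt i.1.2 k.2⟩, by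
    have := par_flip (i := i.1) k.2
    rw [i.2] at this
    exact this⟩

/-- The neighbor of an odd vertex in direction `k`. -/
def OddVertex.nbr {n : ℕ} (j : OddVertex n) (k : Fin n) : EvenVertex n :=
  ⟨⟨flipDigit j.1 k, flip_lt j.1.2 k.2⟩, by
    have := par_flip (i := j.1) k.2
    rw [j.2] at this
    exact this⟩

/-! ### Edge weightings and the representations they induce -/

/-- A complex weighting of the edges of `Q_n`, extended by zero to all pairs of vertices. -/
structure EdgeWeighting (n : ℕ) where
  toFun : EvenVertex n → OddVertex n → ℂ
  zero_off : ∀ i j, ¬ (hypercube n).Adj i j → toFun i j = 0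

namespace EdgeWeighting

variable {n : ℕ}

/-- The even vertices of the subgraph induced by the edges of nonzero weight. -/
abbrev EvenSupport (c : EdgeWeighting n) : Type := {i : EvenVertex n // ∃ j, c.toFun i j ≠ 0}

noncomputable instance (c : EdgeWeighting n) : Fintype c.EvenSupport := Fintype.ofFinite _

/-- Admissible weightings. The sums run over the common neighbors, as the weight is zero off the
edges. -/
structure Admissible (c : EdgeWeighting n) : Prop where
  odd : ∀ j₁ j₂, (∃ i, c.toFun i j₁ ≠ 0) → (∃ i, c.toFun i j₂ ≠ 0) →
    ∑ i, c.toFun i j₁ * star (c.toFun i j₂) = if j₁ = j₂ then 1 else 0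
  even : ∀ i₁ i₂, (∃ j, c.toFun i₁ j ≠ 0) → (∃ j, c.toFun i₂ j ≠ 0) →
    ∑ j, c.toFun i₁ j * star (c.toFun i₂ j) = if i₁ = i₂ then 1 else 0

/-- The matrices assigned to the generators: the matrix unit `E_{ii}` for an even vertex `i` of the
support (zero for other even vertices), and `[c(i₁ j) conj(c(i₂ j))]` for an odd vertex `j` (which
is zero if `j` is not in the support). -/
noncomputable def genMatrix (c : EdgeWeighting n) :
    EvenVertex n ⊕ OddVertex n → Matrix c.EvenSupport c.EvenSupport ℂ
  | .inl i => Matrix.diagonal fun a => if a.1 = i then 1 else 0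
  | .inr j => Matrix.of fun a b => c.toFun a.1 j * star (c.toFun b.1 j)

lemma isGraphFamily_genMatrix {c : EdgeWeighting n} (hc : c.Admissible) :
    IsGraphFamily (hypercube n) c.genMatrix where
  proj x := by
    rcases x with i | j
    · refine ⟨?_, ?_⟩
      · rw [IsIdempotentElem, genMatrix, Matrix.diagonal_mul_diagonal]
        congr 1
        ext a
        split_ifs <;> simp
      · rw [IsSelfAdjoint, genMatrix, Matrix.star_eq_conjTranspose,
          Matrix.diagonal_conjTranspose]
        congr 1
        ext a
        simp only [Pi.star_apply]
        split_ifs <;> simp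
    · refine ⟨?_, ?_⟩
      · ext a b
        rw [Matrix.mul_apply]
        simp only [genMatrix, Matrix.of_apply]
        by_cases hj : ∃ i, c.toFun i j ≠ 0
        · have h1 : ∑ d : c.EvenSupport, c.toFun d.1 j * star (c.toFun d.1 j) = 1 := by
            have h2 := hc.odd j j hj hj
            rw [if_pos rfl] at h2
            rw [← h2]
            refine Fintype.sum_of_injective Subtype.val Subtype.val_injective _ _ ?_ fun _ => rfl
            intro i hi
            have : c.toFun i j = 0 := by
              by_contra h
              exact hi ⟨⟨i, j, h⟩, rfl⟩
            rw [this, zero_mul]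
          calc ∑ d : c.EvenSupport, c.toFun a.1 j * star (c.toFun d.1 j) *
                (c.toFun d.1 j * star (c.toFun b.1 j))
              = c.toFun a.1 j * star (c.toFun b.1 j) *
                ∑ d : c.EvenSupport, c.toFun d.1 j * star (c.toFun d.1 j) := by
                rw [Finset.mul_sum]
                exact Finset.sum_congr rfl fun d _ => by ring
            _ = _ := by rw [h1, mul_one]
        · push Not at hj
          simp [hj]
      · ext a b
        simp [genMatrix, Matrix.star_apply, mul_comm]
  sum_left := by
    ext a b
    rw [Matrix.sum_apply]
    by_cases hab : a = b
    · subst hab; simp [genMatrix]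
    · simp [genMatrix, Matrix.diagonal_apply_ne _ hab, Matrix.one_apply_ne hab]
  sum_right := by
    ext a b
    rw [Matrix.sum_apply, Matrix.one_apply]
    have := hc.even a.1 b.1 a.2 b.2
    simp only [genMatrix, Matrix.of_apply]
    rw [this]
    simp [Subtype.ext_iff]
  orth i j hij := by
    ext a b
    simp only [genMatrix, Matrix.diagonal_mul, Matrix.of_apply, Matrix.zero_apply]
    split_ifs with h
    · rw [h, c.zero_off i j hij]; simp
    · simp

lemma isGraphFamily_map {U V : Type*} [Fintype U] [Fintype V] {G : BipartiteGraph U V}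
    {B C : Type*} [Ring B] [StarRing B] [Algebra ℂ B] [Ring C] [StarRing C] [Algebra ℂ C]
    {p : U ⊕ V → B} (hp : IsGraphFamily G p) (φ : B →⋆ₐ[ℂ] C) :
    IsGraphFamily G fun x => φ (p x) where
  proj x := ⟨by rw [IsIdempotentElem, ← map_mul, (hp.proj x).isIdempotentElem.eq],
    by rw [IsSelfAdjoint, ← map_star, (hp.proj x).isSelfAdjoint.star_eq]⟩
  sum_left := by rw [← map_sum, hp.sum_left, map_one]
  sum_right := by rw [← map_sum, hp.sum_right, map_one]
  orth u v h := by rw [← map_mul, hp.orth u v h, map_zero]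

/-- The representation of `C*(Q_n)` on `ℂ^{U_n(c)}` induced by an admissible weighting `c`. -/
noncomputable def inducedRep (c : EdgeWeighting n) (hc : c.Admissible) :
    CStarAlg (hypercube n) →⋆ₐ[ℂ]
      (EuclideanSpace ℂ c.EvenSupport →L[ℂ] EuclideanSpace ℂ c.EvenSupport) :=
  CStarAlg.lift (isGraphFamily_map (isGraphFamily_genMatrix hc)
    (Matrix.toEuclideanCLM (n := c.EvenSupport) (𝕜 := ℂ) : _ →⋆ₐ[ℂ] _))

end EdgeWeighting

/-! ### The weightings and representations parametrized by the simplex -/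

section Simplex

variable {n : ℕ} (t : stdSimplex ℝ (Fin n))

/-- The weighting with value `(-1) ^ par_k(i) * √(t_k)` on the edge from `i` to `j = flipDigit i k`. The
sum has exactly one nonzero summand on an edge, since `k` is determined by `i` and `j`. -/
noncomputable def simplexWeighting : EdgeWeighting n where
  toFun i j := ∑ k : Fin n, if flipDigit i.1 k = j.1 then (((-1) ^ par k i.1 * √(t.1 k) : ℝ) : ℂ) else 0
  zero_off _ _ h := Finset.sum_eq_zero fun k _ => if_neg fun hk => h ⟨k, k.2, hk⟩

lemma simplexWeighting_apply (i : EvenVertex n) (j : OddVertex n) (k : Fin n)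
    (h : flipDigit i.1 k = j.1) :
    (simplexWeighting t).toFun i j = (((-1) ^ par k i.1 * √(t.1 k) : ℝ) : ℂ) := by
  rw [simplexWeighting]
  dsimp only
  rw [Finset.sum_eq_single k, if_pos h]
  · intro l _ hl
    rw [if_neg]
    intro hl'
    exact hl (Fin.ext (flip_inj.1 (hl'.trans h.symm)))
  · simp

/-- The real sum underlying both orthogonality relations. -/
lemma sum_sum_flip (a b : ℕ) :
    ∑ k : Fin n, ∑ l : Fin n, (if flipDigit a k = flipDigit b l then
      ((-1) ^ par k a * √(t.1 k)) * ((-1) ^ par l b * √(t.1 l)) else 0)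
      = if a = b then (1 : ℝ) else 0 := by
  split_ifs with hab
  · subst hab
    calc _ = ∑ k : Fin n, t.1 k := by
          refine Finset.sum_congr rfl fun k _ => ?_
          rw [Finset.sum_eq_single k, if_pos rfl]
          · have h1 : ((-1 : ℝ) ^ par k a) * ((-1) ^ par k a) = 1 := by
              rw [← mul_pow]; simp
            have h2 := Real.mul_self_sqrt (t.2.1 k)
            calc _ = ((-1 : ℝ) ^ par k a * (-1) ^ par k a) * (√(t.1 k) * √(t.1 k)) := by ring
              _ = _ := by rw [h1, h2, one_mul]
          · intro l _ hl
            rw [if_neg]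
            intro h
            exact hl (Fin.ext (flip_inj.1 h)).symm
          · simp
      _ = 1 := t.2.2
  · set f : Fin n → Fin n → ℝ := fun k l => if flipDigit a k = flipDigit b l then
      ((-1) ^ par k a * √(t.1 k)) * ((-1) ^ par l b * √(t.1 l)) else 0 with hf
    have hanti : ∀ k l, f k l = - f l k := by
      intro k l
      simp only [hf]
      by_cases h : flipDigit a k = flipDigit b l
      · have hb : b = flipDigit (flipDigit a k) l := by rw [h, flip_flip]
        have h' : flipDigit a l = flipDigit b k := by rw [hb, flip_comm, flip_flip]
        rw [if_pos h, if_pos h']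
        have hkl : (k : ℕ) ≠ l := by
          intro hkl
          apply hab
          rw [hb, hkl, flip_flip]
        rw [hb]
        simp only [neg_one_pow_par_flip]
        rcases lt_or_gt_of_ne hkl with hlt | hlt
        · simp only [le_refl, hlt.le, not_le.2 hlt, if_true, if_false]
          ring
        · simp only [le_refl, hlt.le, not_le.2 hlt, if_true, if_false]
          ring
      · have h' : ¬ flipDigit a l = flipDigit b k := by
          intro h'
          apply h
          have hb : b = flipDigit (flipDigit a l) k := by rw [h', flip_flip]
          rw [hb, flip_comm, flip_flip]
        rw [if_neg h, if_neg h', neg_zero]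
    have h2 : ∑ k, ∑ l, f k l = - ∑ k, ∑ l, f k l := by
      conv_lhs => rw [Finset.sum_comm]
      rw [← Finset.sum_neg_distrib]
      refine Finset.sum_congr rfl fun k _ => ?_
      rw [← Finset.sum_neg_distrib]
      exact Finset.sum_congr rfl fun l _ => hanti l k
    linarith

lemma simplexWeighting_eq_nbr (i : EvenVertex n) (j : OddVertex n) :
    (simplexWeighting t).toFun i j
      = ∑ k : Fin n, if i.nbr k = j then (((-1) ^ par k i.1 * √(t.1 k) : ℝ) : ℂ) else 0 := by
  simp only [simplexWeighting]
  refine Finset.sum_congr rfl fun k _ => ?_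
  congr 1
  simp [EvenVertex.nbr, Subtype.ext_iff, Fin.ext_iff]

lemma simplexWeighting_eq_nbr' (i : EvenVertex n) (j : OddVertex n) :
    (simplexWeighting t).toFun i j
      = ∑ k : Fin n, if j.nbr k = i then ((-((-1) ^ par k j.1 * √(t.1 k)) : ℝ) : ℂ) else 0 := by
  simp only [simplexWeighting]
  refine Finset.sum_congr rfl fun k _ => ?_
  have h : flipDigit i.1 k = j.1 ↔ j.nbr k = i := by
    simp only [OddVertex.nbr, Subtype.ext_iff, Fin.ext_iff]
    constructor
    · intro h; rw [← h, flip_flip]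
    · intro h; rw [← h, flip_flip]
  by_cases hk : flipDigit i.1 k = j.1
  · rw [if_pos hk, if_pos (h.1 hk), ← hk, neg_one_pow_par_flip, if_pos le_rfl]
    simp
  · rw [if_neg hk, if_neg (mt h.2 hk)]

/-- The weighting `c_t` is admissible. -/
theorem simplexWeighting_admissible : (simplexWeighting t).Admissible where
  odd j₁ j₂ _ _ := by
    have h := sum_sum_flip t (j₁.1 : ℕ) j₂.1
    have e : (j₁ = j₂) ↔ ((j₁.1 : ℕ) = j₂.1) := by simp [Subtype.ext_iff, Fin.ext_iff]
    have h' := congrArg (fun x : ℝ => (x : ℂ)) h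
    simp only [← e] at h'
    rw [apply_ite (fun x : ℝ => (x : ℂ)), Complex.ofReal_one, Complex.ofReal_zero] at h'
    rw [← h']
    simp only [simplexWeighting_eq_nbr', star_sum, Finset.sum_mul_sum]
    rw [Finset.sum_comm]
    push_cast
    refine Finset.sum_congr rfl fun k _ => ?_
    rw [Finset.sum_comm]
    refine Finset.sum_congr rfl fun l _ => ?_
    simp only [ite_mul, zero_mul, Finset.sum_ite_eq, Finset.mem_univ, if_true]
    have e2 : (j₂.nbr l = j₁.nbr k) ↔ flipDigit j₁.1 k = flipDigit j₂.1 l := by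
      simp only [OddVertex.nbr, Subtype.ext_iff, Fin.ext_iff]
      exact eq_comm
    by_cases hk : flipDigit j₁.1 k = flipDigit j₂.1 l
    · rw [if_pos (e2.2 hk), if_pos hk]
      simp
    · rw [if_neg (mt e2.1 hk), if_neg hk]
      simp
  even i₁ i₂ _ _ := by
    have h := sum_sum_flip t (i₁.1 : ℕ) i₂.1
    have e : (i₁ = i₂) ↔ ((i₁.1 : ℕ) = i₂.1) := by simp [Subtype.ext_iff, Fin.ext_iff]
    have h' := congrArg (fun x : ℝ => (x : ℂ)) h
    simp only [← e] at h'
    rw [apply_ite (fun x : ℝ => (x : ℂ)), Complex.ofReal_one, Complex.ofReal_zero] at h'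
    rw [← h']
    simp only [simplexWeighting_eq_nbr, star_sum, Finset.sum_mul_sum]
    rw [Finset.sum_comm]
    push_cast
    refine Finset.sum_congr rfl fun k _ => ?_
    rw [Finset.sum_comm]
    refine Finset.sum_congr rfl fun l _ => ?_
    simp only [ite_mul, zero_mul, Finset.sum_ite_eq, Finset.mem_univ, if_true]
    have e2 : (i₂.nbr l = i₁.nbr k) ↔ flipDigit i₁.1 k = flipDigit i₂.1 l := by
      simp only [EvenVertex.nbr, Subtype.ext_iff, Fin.ext_iff]
      exact eq_comm
    by_cases hk : flipDigit i₁.1 k = flipDigit i₂.1 l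
    · rw [if_pos (e2.2 hk), if_pos hk]
      simp
    · rw [if_neg (mt e2.1 hk), if_neg hk]
      simp

/-- Every even vertex lies in the support of `c_t`, that is, `U_n(c_t) = U_n`. -/
theorem simplexWeighting_support (i : EvenVertex n) : ∃ j, (simplexWeighting t).toFun i j ≠ 0 := by
  obtain ⟨k, hk⟩ : ∃ k, t.1 k ≠ 0 := by
    by_contra! h
    have := t.2.2
    simp [h] at this
  refine ⟨i.nbr k, ?_⟩
  rw [simplexWeighting_apply t i (i.nbr k) k rfl]
  have h0 : 0 < t.1 k := lt_of_le_of_ne (t.2.1 k) (Ne.symm hk)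
  have := Real.sqrt_pos.2 h0
  exact Complex.ofReal_ne_zero.2 (mul_ne_zero (pow_ne_zero _ (by norm_num)) this.ne')

/-- The representation `ρ_t` of `C*(Q_n)` on `ℂ^{U_n}` induced by the weighting `c_t`; the index set
`U_n(c_t)` is identified with `U_n`. -/
noncomputable def rhoT :
    CStarAlg (hypercube n) →⋆ₐ[ℂ]
      (EuclideanSpace ℂ (EvenVertex n) →L[ℂ] EuclideanSpace ℂ (EvenVertex n)) :=
  ((LinearIsometryEquiv.piLpCongrLeft 2 ℂ ℂ
    (Equiv.subtypeUnivEquiv (simplexWeighting_support t))).conjStarAlgEquiv : _ →⋆ₐ[ℂ] _).comp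
    ((simplexWeighting t).inducedRep (simplexWeighting_admissible t))

lemma inducedRep_p (c : EdgeWeighting n) (hc : c.Admissible) (x : EvenVertex n ⊕ OddVertex n) :
    c.inducedRep hc (CStarAlg.p (hypercube n) x)
      = Matrix.toEuclideanCLM (n := c.EvenSupport) (𝕜 := ℂ) (c.genMatrix x) :=
  CStarAlg.lift_p _ x

lemma rhoT_apply (x : EvenVertex n ⊕ OddVertex n) (v : EuclideanSpace ℂ (EvenVertex n))
    (i : EvenVertex n) :
    rhoT t (CStarAlg.p (hypercube n) x) v i
      = ∑ b : (simplexWeighting t).EvenSupport,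
        (simplexWeighting t).genMatrix x ⟨i, simplexWeighting_support t i⟩ b * v b.1 := by
  change (LinearIsometryEquiv.piLpCongrLeft 2 ℂ ℂ
    (Equiv.subtypeUnivEquiv (simplexWeighting_support t))).conjStarAlgEquiv
    ((simplexWeighting t).inducedRep (simplexWeighting_admissible t)
      (CStarAlg.p (hypercube n) x)) v i = _
  rw [inducedRep_p]
  rfl

/-- `ρ_t(p_i)` is the matrix unit `E_{ii}` for an even vertex `i`. -/
theorem rhoT_even (i : EvenVertex n) :
    rhoT t (CStarAlg.p (hypercube n) (.inl i))
      = Matrix.toEuclideanCLM (n := EvenVertex n) (𝕜 := ℂ) (Matrix.single i i 1) := by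
  refine ContinuousLinearMap.ext fun v => PiLp.ext fun a => ?_
  rw [rhoT_apply, Matrix.ofLp_toEuclideanCLM]
  change (Matrix.diagonal _ : Matrix _ _ ℂ).mulVec (fun b : (simplexWeighting t).EvenSupport => v b.1) _ = _
  rw [Matrix.mulVec_diagonal, Matrix.single_mulVec]
  by_cases h : a = i
  · subst h; simp
  · simp [h]

/-- `ρ_t(p_j)` is the matrix `[c_t(i₁ j) conj(c_t(i₂ j))]` for an odd vertex `j`. -/
theorem rhoT_odd (j : OddVertex n) :
    rhoT t (CStarAlg.p (hypercube n) (.inr j))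
      = Matrix.toEuclideanCLM (n := EvenVertex n) (𝕜 := ℂ) (Matrix.of fun i₁ i₂ =>
          (simplexWeighting t).toFun i₁ j * star ((simplexWeighting t).toFun i₂ j)) := by
  refine ContinuousLinearMap.ext fun v => PiLp.ext fun a => ?_
  rw [rhoT_apply, Matrix.ofLp_toEuclideanCLM]
  exact Fintype.sum_equiv (Equiv.subtypeUnivEquiv (simplexWeighting_support t)) _
    (fun b => (simplexWeighting t).toFun a j * star ((simplexWeighting t).toFun b j) * v b)
    fun b => rfl

end Simplex

end HypercubeAlgebra

/-!
The point `t` and the intertwiner are both read off from the operators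
`M_k = ∑_i (-1) ^ par_k(i) p_i p_{i#k}` (`edgeSum`), which carry the projection of an odd vertex to
that of its neighbor in direction `k`.

On a square `i, j, i', j'` of the cube, `∑_j p_i p_j p_{i'} = p_i p_{i'} = 0` has two nonzero terms,
so the paths `p_i p_j p_{i'}` and `p_i p_{j'} p_{i'}` are opposite (`IsCubeFamily.square_left`,
`IsCubeFamily.square_right`). The signs in `M_k` compensate this, and `M_k M_l^* = M_l M_k^*`,
`M_k^* M_l = M_l^* M_k`. It follows that `M_k M_k^* = M_k^* M_k` commutes with all generators
(`IsCubeFamily.commute_edgeSum_mul_star`); moreover these positive elements sum to `1`. In an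
irreducible representation they are scalars `t_k` by Schur's lemma
(`IsIrreducible.exists_eq_algebraMap`), and this is the point `t` of the simplex.

In the model `ρ_t` the sum `y` of the basis vectors and the corresponding vector `z` for the odd
vertices satisfy `M_k z = √t_k y` and `M_k^* y = √t_k z`, and conversely such a pair with `y ≠ 0` in
the given representation makes `e_i ↦ p_i y` a nonzero intertwiner from `ρ_t`
(`IsCubeFamily.right_apply`, `exists_intertwiner`). If `t_{k₀} > 0`, then `y` has only to be a common
eigenvector of the operators `M_{k₀} M_l^*` for the eigenvalues `√(t_{k₀} t_l)`; these commute and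
have scalar squares, and the signs of the eigenvalues can be prescribed because flipping the sign of
the vectors `p_i y` with `[i]_l = 1` changes exactly the eigenvalue with index `l`
(`IsCubeFamily.exists_eigenvector`). Finally, for a nonzero intertwiner `S` from `ρ_t` the operator
`S S^*` is a scalar, again by Schur's lemma, so that a multiple of `S^*` is an isometry of the given
space onto a reducing subspace (`IsIrreducible.equivToSubrep`).
-/

namespace HypercubeAlgebra

/-! ### Signs and neighbors in the cube -/

/-- The sign `(-1) ^ par_k(m)`, as an integer, so that it acts on every ring. -/
def parSign (k m : ℕ) : ℤ := (-1) ^ par k m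

lemma parSign_mul_self (k m : ℕ) : parSign k m * parSign k m = 1 := by
  rw [parSign, ← mul_pow]; simp

lemma parSign_flip (k m l : ℕ) :
    parSign k (flipDigit m l) = if l ≤ k then -parSign k m else parSign k m := by
  have h := neg_one_pow_par_flip k m l
  unfold parSign
  split_ifs at h ⊢ with hl <;> exact_mod_cast h

/-- Changing the order in which two different digits are flipped changes the sign picked up. -/
lemma parSign_mul_flip_flip {k l : ℕ} (hkl : k ≠ l) (m : ℕ) :
    parSign l m * parSign k (flipDigit (flipDigit m l) k)
      = -(parSign k m * parSign l (flipDigit (flipDigit m k) l)) := by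
  simp only [parSign_flip, le_refl, if_true]
  rcases lt_or_gt_of_ne hkl with h | h
  · rw [if_neg (not_le.2 h), if_pos h.le]; ring
  · rw [if_pos h.le, if_neg (not_le.2 h)]; ring

/-- The common neighbors of two vertices at distance two are the two evident ones. -/
lemma eq_or_eq_of_flip_eq {m a b k l : ℕ} (hkl : k ≠ l)
    (h : flipDigit (flipDigit m a) b = flipDigit (flipDigit m k) l) : a = k ∨ a = l := by
  by_contra! hc
  have hk := congrArg (Nat.testBit · k) h
  have hl := congrArg (Nat.testBit · l) h
  simp only [testBit_flip, if_neg hc.1.symm, if_neg hc.2.symm, if_neg hkl, if_neg hkl.symm,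
    if_true] at hk hl
  split_ifs at hk hl with h1 h2
  · exact hkl (h1.trans h2.symm)
  all_goals simp at hk hl

variable {n : ℕ}

lemma EvenVertex.ext_val {i i' : EvenVertex n} (h : (i.1 : ℕ) = i'.1) : i = i' :=
  Subtype.ext (Fin.ext h)

lemma OddVertex.ext_val {j j' : OddVertex n} (h : (j.1 : ℕ) = j'.1) : j = j' :=
  Subtype.ext (Fin.ext h)

lemma EvenVertex.nbr_nbr (i : EvenVertex n) (k : Fin n) : (i.nbr k).nbr k = i :=
  EvenVertex.ext_val (flip_flip _ _)

lemma OddVertex.nbr_nbr (j : OddVertex n) (k : Fin n) : (j.nbr k).nbr k = j :=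
  OddVertex.ext_val (flip_flip _ _)

lemma EvenVertex.nbr_comm (i : EvenVertex n) (k l : Fin n) :
    (i.nbr k).nbr l = (i.nbr l).nbr k :=
  EvenVertex.ext_val (flip_comm _ _ _)

lemma OddVertex.nbr_comm (j : OddVertex n) (k l : Fin n) :
    (j.nbr k).nbr l = (j.nbr l).nbr k :=
  OddVertex.ext_val (flip_comm _ _ _)

lemma EvenVertex.nbr_injective (i : EvenVertex n) : Function.Injective i.nbr := fun _ _ h =>
  Fin.ext (flip_inj.1 (congrArg (fun j : OddVertex n => (j.1 : ℕ)) h))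

lemma OddVertex.nbr_injective (j : OddVertex n) : Function.Injective j.nbr := fun _ _ h =>
  Fin.ext (flip_inj.1 (congrArg (fun i : EvenVertex n => (i.1 : ℕ)) h))

lemma adj_iff_exists_nbr {i : EvenVertex n} {j : OddVertex n} :
    (hypercube n).Adj i j ↔ ∃ k, i.nbr k = j := by
  constructor
  · rintro ⟨k, hk, h⟩
    exact ⟨⟨k, hk⟩, OddVertex.ext_val h⟩
  · rintro ⟨k, rfl⟩
    exact ⟨k, k.2, rfl⟩

lemma adj_iff_exists_nbr' {i : EvenVertex n} {j : OddVertex n} :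
    (hypercube n).Adj i j ↔ ∃ k, j.nbr k = i := by
  rw [adj_iff_exists_nbr]
  constructor
  · rintro ⟨k, rfl⟩
    exact ⟨k, i.nbr_nbr k⟩
  · rintro ⟨k, rfl⟩
    exact ⟨k, j.nbr_nbr k⟩

/-! ### The relations in the algebra of the cube -/

/-- If `∑ q = 1` and only two of the products `a q_v b` can be nonzero, where `a b = 0`, then
these two are opposite. -/
lemma mul_mul_eq_neg_of_sum_eq_one {B V : Type*} [Ring B] [Fintype V] {q : V → B}
    (hq : ∑ v, q v = 1) {a b : B} (hab : a * b = 0) {v w : V} (hvw : v ≠ w)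
    (h : ∀ u, u ≠ v → u ≠ w → a * q u * b = 0) : a * q v * b = -(a * q w * b) := by
  classical
  have h1 : ∑ u, a * q u * b = 0 := by
    rw [← Finset.sum_mul, ← Finset.mul_sum, hq, mul_one, hab]
  rw [← Finset.sum_subset (Finset.subset_univ {v, w}) (by
    intro u _ hu
    simp only [Finset.mem_insert, Finset.mem_singleton, not_or] at hu
    exact h u hu.1 hu.2), Finset.sum_pair hvw] at h1
  exact eq_neg_of_add_eq_zero_left h1

/-- A family of projections satisfying the relations of `C*(Q_n)`, together with the orthogonality
within each of the two vertex classes. The latter is automatic in a C*-algebra, but not in a general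
star-ring. -/
structure IsCubeFamily {B : Type*} [Ring B] [StarRing B] (p : EvenVertex n ⊕ OddVertex n → B) :
    Prop extends IsGraphFamily (hypercube n) p where
  orth_left : ∀ i i', i ≠ i' → p (.inl i) * p (.inl i') = 0
  orth_right : ∀ j j', j ≠ j' → p (.inr j) * p (.inr j') = 0

/-- The operator `M_k = ∑_i (-1) ^ par_k(i) p_i p_{i#k}`, which exchanges the two vertex classes
along the edges in direction `k`. -/
noncomputable def edgeSum {B : Type*} [Ring B] (p : EvenVertex n ⊕ OddVertex n → B) (k : Fin n) :
    B :=
  ∑ i : EvenVertex n, parSign k i.1 • (p (.inl i) * p (.inr (i.nbr k)))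

/-- The sign operator `Z_l = ∑_i (-1)^{[i]_l} p_i`, over the even vertices `i`. -/
noncomputable def digitSign {B : Type*} [Ring B]
    (p : EvenVertex n ⊕ OddVertex n → B) (l : Fin n) : B :=
  ∑ i : EvenVertex n, (-1 : ℤ) ^ ((i.1 : ℕ).testBit l).toNat • p (.inl i)

namespace IsCubeFamily

variable {B : Type*} [Ring B] [StarRing B] {p : EvenVertex n ⊕ OddVertex n → B}

lemma star_eq (hp : IsCubeFamily p) (x : EvenVertex n ⊕ OddVertex n) : star (p x) = p x :=
  (hp.proj x).isSelfAdjoint.star_eq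

lemma mul_self (hp : IsCubeFamily p) (x : EvenVertex n ⊕ OddVertex n) : p x * p x = p x :=
  (hp.proj x).isIdempotentElem.eq

lemma orth' (hp : IsCubeFamily p) {i : EvenVertex n} {j : OddVertex n}
    (h : ¬ (hypercube n).Adj i j) : p (.inr j) * p (.inl i) = 0 := by
  rw [← star_star (p (.inr j) * p (.inl i)), star_mul, hp.star_eq, hp.star_eq, hp.orth i j h,
    star_zero]

lemma ext_left (hp : IsCubeFamily p) {a b : B} (h : ∀ i, p (.inl i) * a = p (.inl i) * b) :
    a = b := by
  rw [← one_mul a, ← one_mul b, ← hp.sum_left, Finset.sum_mul, Finset.sum_mul]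
  exact Finset.sum_congr rfl fun i _ => h i

lemma ext_right (hp : IsCubeFamily p) {a b : B} (h : ∀ j, p (.inr j) * a = p (.inr j) * b) :
    a = b := by
  rw [← one_mul a, ← one_mul b, ← hp.sum_right, Finset.sum_mul, Finset.sum_mul]
  exact Finset.sum_congr rfl fun i _ => h i

/-- The two paths of length two from `i` to the opposite corner of a square are opposite. -/
lemma square_left (hp : IsCubeFamily p) (i : EvenVertex n) {k l : Fin n} (hkl : k ≠ l) :
    p (.inl i) * p (.inr (i.nbr k)) * p (.inl ((i.nbr k).nbr l))
      = -(p (.inl i) * p (.inr (i.nbr l)) * p (.inl ((i.nbr l).nbr k))) := by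
  rw [← i.nbr_comm k l]
  refine mul_mul_eq_neg_of_sum_eq_one (q := fun j => p (.inr j)) hp.sum_right
    (hp.orth_left _ _ ?_) (i.nbr_injective.ne hkl) ?_
  · intro h
    exact hkl ((i.nbr k).nbr_injective ((i.nbr_nbr k).trans h))
  · intro j hk hl
    by_cases h1 : (hypercube n).Adj i j
    · by_cases h2 : (hypercube n).Adj ((i.nbr k).nbr l) j
      · exfalso
        obtain ⟨a, rfl⟩ := adj_iff_exists_nbr.1 h1
        obtain ⟨b, hb⟩ := adj_iff_exists_nbr'.1 h2
        rcases eq_or_eq_of_flip_eq (Fin.val_ne_of_ne hkl)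
          (congrArg (fun v : EvenVertex n => (v.1 : ℕ)) hb) with h | h
        · exact hk (by rw [Fin.ext h])
        · exact hl (by rw [Fin.ext h])
      · rw [mul_assoc, hp.orth' h2, mul_zero]
    · rw [hp.orth i j h1, zero_mul]

lemma square_right (hp : IsCubeFamily p) (j : OddVertex n) {k l : Fin n} (hkl : k ≠ l) :
    p (.inr j) * p (.inl (j.nbr k)) * p (.inr ((j.nbr k).nbr l))
      = -(p (.inr j) * p (.inl (j.nbr l)) * p (.inr ((j.nbr l).nbr k))) := by
  rw [← j.nbr_comm k l]
  refine mul_mul_eq_neg_of_sum_eq_one (q := fun i => p (.inl i)) hp.sum_left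
    (hp.orth_right _ _ ?_) (j.nbr_injective.ne hkl) ?_
  · intro h
    exact hkl ((j.nbr k).nbr_injective ((j.nbr_nbr k).trans h))
  · intro i hk hl
    by_cases h1 : (hypercube n).Adj i j
    · by_cases h2 : (hypercube n).Adj i ((j.nbr k).nbr l)
      · exfalso
        obtain ⟨a, rfl⟩ := adj_iff_exists_nbr'.1 h1
        obtain ⟨b, hb⟩ := adj_iff_exists_nbr.1 h2
        rcases eq_or_eq_of_flip_eq (Fin.val_ne_of_ne hkl)
          (congrArg (fun v : OddVertex n => (v.1 : ℕ)) hb) with h | h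
        · exact hk (by rw [Fin.ext h])
        · exact hl (by rw [Fin.ext h])
      · rw [mul_assoc, hp.orth _ _ h2, mul_zero]
    · rw [hp.orth' h1, zero_mul]

lemma left_mul_edgeSum (hp : IsCubeFamily p) (i : EvenVertex n) (k : Fin n) :
    p (.inl i) * edgeSum p k = parSign k i.1 • (p (.inl i) * p (.inr (i.nbr k))) := by
  rw [edgeSum, Finset.mul_sum, Finset.sum_eq_single i]
  · rw [mul_smul_comm, ← mul_assoc, hp.mul_self]
  · intro i' _ h
    rw [mul_smul_comm, ← mul_assoc, hp.orth_left _ _ h.symm, zero_mul, smul_zero]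
  · simp

lemma edgeSum_mul_right (hp : IsCubeFamily p) (i : EvenVertex n) (k : Fin n) :
    edgeSum p k * p (.inr (i.nbr k)) = parSign k i.1 • (p (.inl i) * p (.inr (i.nbr k))) := by
  rw [edgeSum, Finset.sum_mul, Finset.sum_eq_single i]
  · rw [smul_mul_assoc, mul_assoc, hp.mul_self]
  · intro i' _ h
    rw [smul_mul_assoc, mul_assoc, hp.orth_right, mul_zero, smul_zero]
    intro h'
    apply h
    rw [← i'.nbr_nbr k, h', i.nbr_nbr]
  · simp

/-- `M_k` moves the projections along the edges in direction `k`. -/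
lemma left_mul_edgeSum_comm (hp : IsCubeFamily p) (i : EvenVertex n) (k : Fin n) :
    p (.inl i) * edgeSum p k = edgeSum p k * p (.inr (i.nbr k)) := by
  rw [hp.left_mul_edgeSum, hp.edgeSum_mul_right]

lemma right_mul_star_edgeSum_comm (hp : IsCubeFamily p) (j : OddVertex n) (k : Fin n) :
    p (.inr j) * star (edgeSum p k) = star (edgeSum p k) * p (.inl (j.nbr k)) := by
  have h := congrArg star (hp.left_mul_edgeSum_comm (j.nbr k) k)
  rw [star_mul, star_mul, hp.star_eq, hp.star_eq, j.nbr_nbr] at h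
  exact h.symm

lemma right_mul_star_edgeSum (hp : IsCubeFamily p) (j : OddVertex n) (k : Fin n) :
    p (.inr j) * star (edgeSum p k)
      = parSign k (j.nbr k).1 • (p (.inr j) * p (.inl (j.nbr k))) := by
  have h := congrArg star (hp.edgeSum_mul_right (j.nbr k) k)
  rw [star_mul, star_zsmul, star_mul, hp.star_eq, hp.star_eq, j.nbr_nbr] at h
  exact h

lemma edgeSum_mul_star_comm (hp : IsCubeFamily p) (k l : Fin n) :
    edgeSum p k * star (edgeSum p l) = edgeSum p l * star (edgeSum p k) := by
  rcases eq_or_ne k l with rfl | hkl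
  · rfl
  refine hp.ext_left fun i => ?_
  have key (a b : Fin n) : p (.inl i) * (edgeSum p a * star (edgeSum p b))
      = (parSign a i.1 * parSign b ((i.nbr a).nbr b).1) •
        (p (.inl i) * p (.inr (i.nbr a)) * p (.inl ((i.nbr a).nbr b))) := by
    rw [← mul_assoc, hp.left_mul_edgeSum, smul_mul_assoc, mul_assoc, hp.right_mul_star_edgeSum,
      mul_smul_comm, smul_smul, mul_assoc]
  rw [key, key, hp.square_left i hkl, smul_neg, ← neg_smul]
  congr 1
  have := parSign_mul_flip_flip (Fin.val_ne_of_ne hkl) (i.1 : ℕ)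
  exact this.symm

lemma star_edgeSum_mul_comm (hp : IsCubeFamily p) (k l : Fin n) :
    star (edgeSum p k) * edgeSum p l = star (edgeSum p l) * edgeSum p k := by
  rcases eq_or_ne k l with rfl | hkl
  · rfl
  refine hp.ext_right fun j => ?_
  have key (a b : Fin n) : p (.inr j) * (star (edgeSum p a) * edgeSum p b)
      = (parSign a (j.nbr a).1 * parSign b (j.nbr a).1) •
        (p (.inr j) * p (.inl (j.nbr a)) * p (.inr ((j.nbr a).nbr b))) := by
    rw [← mul_assoc, hp.right_mul_star_edgeSum, smul_mul_assoc, mul_assoc, hp.left_mul_edgeSum,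
      mul_smul_comm, smul_smul, mul_assoc]
  rw [key, key, hp.square_right j hkl, smul_neg, ← neg_smul]
  congr 1
  have := parSign_mul_flip_flip (Fin.val_ne_of_ne hkl) (j.1 : ℕ)
  change -(parSign k (flipDigit j.1 k) * parSign l (flipDigit j.1 k))
    = parSign l (flipDigit j.1 l) * parSign k (flipDigit j.1 l)
  simp only [parSign_flip, le_refl, if_true] at this ⊢
  split_ifs at this ⊢ <;> linarith

/-- `M_k M_k^*` and `M_k^* M_k` are intertwined by every `M_l`. -/
lemma edgeSum_mul_star_mul (hp : IsCubeFamily p) (k l : Fin n) :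
    edgeSum p k * star (edgeSum p k) * edgeSum p l
      = edgeSum p l * (star (edgeSum p k) * edgeSum p k) := by
  rw [mul_assoc, hp.star_edgeSum_mul_comm k l, ← mul_assoc, hp.edgeSum_mul_star_comm k l,
    mul_assoc]

lemma commute_left (hp : IsCubeFamily p) (i : EvenVertex n) (k : Fin n) :
    Commute (p (.inl i)) (edgeSum p k * star (edgeSum p k)) := by
  rw [Commute, SemiconjBy, ← mul_assoc, hp.left_mul_edgeSum_comm, mul_assoc,
    hp.right_mul_star_edgeSum_comm, i.nbr_nbr, mul_assoc]

lemma commute_right (hp : IsCubeFamily p) (j : OddVertex n) (k : Fin n) :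
    Commute (p (.inr j)) (star (edgeSum p k) * edgeSum p k) := by
  rw [Commute, SemiconjBy, ← mul_assoc, hp.right_mul_star_edgeSum_comm, mul_assoc,
    hp.left_mul_edgeSum_comm, j.nbr_nbr, mul_assoc]

/-- The operators `M_k` are normal: every product `p_i p_j` over an edge is, up to sign, of the form
`p_i M_l`, which intertwines `M_k M_k^*` with `M_k^* M_k`, and these products sum to `1`. -/
lemma edgeSum_mul_star_self (hp : IsCubeFamily p) (k : Fin n) :
    edgeSum p k * star (edgeSum p k) = star (edgeSum p k) * edgeSum p k := by
  have key (i : EvenVertex n) (j : OddVertex n) :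
      p (.inl i) * (edgeSum p k * star (edgeSum p k)) * p (.inr j)
        = p (.inl i) * (star (edgeSum p k) * edgeSum p k) * p (.inr j) := by
    rw [(hp.commute_left i k).eq, mul_assoc (p (.inl i)), ← (hp.commute_right j k).eq]
    by_cases h : (hypercube n).Adj i j
    · obtain ⟨l, rfl⟩ := adj_iff_exists_nbr.1 h
      have e : p (.inl i) * p (.inr (i.nbr l)) = parSign l i.1 • (p (.inl i) * edgeSum p l) := by
        rw [hp.left_mul_edgeSum, smul_smul, parSign_mul_self, one_smul]
      rw [← mul_assoc (p (.inl i)), mul_assoc _ (p (.inl i)), e, mul_smul_comm, smul_mul_assoc,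
        ← mul_assoc, ← (hp.commute_left i k).eq, mul_assoc (p (.inl i)), hp.edgeSum_mul_star_mul,
        mul_assoc (p (.inl i))]
    · rw [mul_assoc, hp.orth i j h, mul_zero, ← mul_assoc, hp.orth i j h, zero_mul]
  refine hp.ext_left fun i => ?_
  rw [← mul_one (p (.inl i) * _), ← mul_one (p (.inl i) * (star _ * _)), ← hp.sum_right,
    Finset.mul_sum, Finset.mul_sum]
  exact Finset.sum_congr rfl fun j _ => key i j

lemma commute_edgeSum_mul_star (hp : IsCubeFamily p) (x : EvenVertex n ⊕ OddVertex n)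
    (k : Fin n) : Commute (p x) (edgeSum p k * star (edgeSum p k)) := by
  rcases x with i | j
  · exact hp.commute_left i k
  · rw [hp.edgeSum_mul_star_self]
    exact hp.commute_right j k

lemma sum_edgeSum_mul_star (hp : IsCubeFamily p) :
    ∑ k, edgeSum p k * star (edgeSum p k) = 1 := by
  refine hp.ext_left fun i => ?_
  have h1 (k : Fin n) : p (.inl i) * (edgeSum p k * star (edgeSum p k))
      = p (.inl i) * p (.inr (i.nbr k)) * p (.inl i) := by
    rw [← mul_assoc, hp.left_mul_edgeSum, smul_mul_assoc, mul_assoc, hp.right_mul_star_edgeSum,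
      i.nbr_nbr, mul_smul_comm, smul_smul, parSign_mul_self, one_smul, mul_assoc]
  have h2 : ∑ k, p (.inl i) * p (.inr (i.nbr k)) = p (.inl i) := by
    conv_rhs => rw [← mul_one (p (.inl i)), ← hp.sum_right, Finset.mul_sum]
    refine Fintype.sum_of_injective i.nbr i.nbr_injective _ _ (fun j hj => ?_) fun _ => rfl
    exact hp.orth i j fun h => hj (adj_iff_exists_nbr.1 h)
  rw [Finset.mul_sum, Finset.sum_congr rfl fun k _ => h1 k, ← Finset.sum_mul, h2, mul_one,
    hp.mul_self]

lemma left_mul_digitSign (hp : IsCubeFamily p) (i : EvenVertex n) (l : Fin n) :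
    p (.inl i) * digitSign p l = (-1 : ℤ) ^ ((i.1 : ℕ).testBit l).toNat • p (.inl i) := by
  rw [digitSign, Finset.mul_sum, Finset.sum_eq_single i]
  · rw [mul_smul_comm, hp.mul_self]
  · intro i' _ h
    rw [mul_smul_comm, hp.orth_left _ _ h.symm, smul_zero]
  · simp

lemma left_mul_edgeSum_mul_star (hp : IsCubeFamily p) (i : EvenVertex n) (k l : Fin n) :
    p (.inl i) * (edgeSum p k * star (edgeSum p l))
      = edgeSum p k * star (edgeSum p l) * p (.inl ((i.nbr k).nbr l)) := by
  rw [← mul_assoc, hp.left_mul_edgeSum_comm, mul_assoc, hp.right_mul_star_edgeSum_comm, mul_assoc]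

/-- Moving along directions `k` and `m` changes the `l`-th digit exactly if one of them is `l`. -/
lemma edgeSum_mul_star_mul_digitSign (hp : IsCubeFamily p) {k l : Fin n} (hkl : k ≠ l)
    (m : Fin n) :
    edgeSum p k * star (edgeSum p m) * digitSign p l
      = (if m = l then (-1 : ℤ) else 1) •
        (digitSign p l * (edgeSum p k * star (edgeSum p m))) := by
  refine hp.ext_left fun i => ?_
  rw [← mul_assoc, hp.left_mul_edgeSum_mul_star, mul_assoc, hp.left_mul_digitSign, mul_smul_comm,
    ← hp.left_mul_edgeSum_mul_star, mul_smul_comm, ← mul_assoc (p (.inl i)) (digitSign p l),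
    hp.left_mul_digitSign, smul_mul_assoc, smul_smul]
  congr 1
  change (-1 : ℤ) ^ ((flipDigit (flipDigit i.1 k) m).testBit l).toNat = _
  simp only [testBit_flip, Fin.val_inj, if_neg hkl.symm]
  by_cases h : l = m
  · rw [if_pos h, if_pos h.symm]
    cases (i.1 : ℕ).testBit l <;> simp
  · rw [if_neg h, if_neg (Ne.symm h), one_mul]

lemma digitSign_mul_self (hp : IsCubeFamily p) (l : Fin n) :
    digitSign p l * digitSign p l = 1 := by
  refine hp.ext_left fun i => ?_
  rw [← mul_assoc, hp.left_mul_digitSign, smul_mul_assoc, hp.left_mul_digitSign, smul_smul,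
    ← mul_pow]
  simp

end IsCubeFamily

/-! ### Intertwiners and Schur's lemma -/

lemma inner_self_eq_ofReal {H : Type*} [NormedAddCommGroup H] [InnerProductSpace ℂ H] (v : H) :
    inner ℂ v v = ((‖v‖ ^ 2 : ℝ) : ℂ) := by
  rw [inner_self_eq_norm_sq_to_K]
  push_cast
  rfl

section Schur

variable {A : Type*} [CStarAlgebra A]
  {H : Type*} [NormedAddCommGroup H] [InnerProductSpace ℂ H] [CompleteSpace H]
  {K : Type*} [NormedAddCommGroup K] [InnerProductSpace ℂ K] [CompleteSpace K]

/-- If `f g = 0` and `f` commutes with an irreducible representation, then `f` or `g` is zero, since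
the kernel of `f` is invariant. -/
lemma IsIrreducible.eq_zero_or_eq_zero {ρ : A →⋆ₐ[ℂ] (H →L[ℂ] H)} (hρ : IsIrreducible ρ)
    {f g : H →L[ℂ] H} (hf : ∀ a, Commute f (ρ a)) (hfg : f * g = 0) : f = 0 ∨ g = 0 := by
  rcases hρ.2 (LinearMap.ker (f : H →ₗ[ℂ] H)) f.isClosed_ker (by
    intro a v hv
    have h := congrArg (fun T : H →L[ℂ] H => T v) (hf a).eq
    change f (ρ a v) = ρ a (f v) at h
    change f v = 0 at hv
    change f (ρ a v) = 0
    rw [h, hv, map_zero]) with h | h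
  · right
    ext v
    have hv : g v ∈ LinearMap.ker (f : H →ₗ[ℂ] H) :=
      congrArg (fun T : H →L[ℂ] H => T v) hfg
    rw [h] at hv
    exact hv
  · left
    ext v
    have hv : v ∈ LinearMap.ker (f : H →ₗ[ℂ] H) := h ▸ Submodule.mem_top
    exact hv

/-- Schur's lemma: a self-adjoint operator commuting with an irreducible representation is a
scalar. Otherwise its spectrum has two different points, and the positive and the negative part of
a shift of the operator contradict `IsIrreducible.eq_zero_or_eq_zero`. -/
theorem IsIrreducible.exists_eq_algebraMap {ρ : A →⋆ₐ[ℂ] (H →L[ℂ] H)} (hρ : IsIrreducible ρ)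
    {T : H →L[ℂ] H} (hT : IsSelfAdjoint T) (hc : ∀ a, Commute T (ρ a)) :
    ∃ c : ℝ, T = algebraMap ℝ (H →L[ℂ] H) c := by
  have := hρ.1
  obtain ⟨c, hc'⟩ := ContinuousFunctionalCalculus.spectrum_nonempty (R := ℝ) T hT
  have key (x y : ℝ) (hx : x ∈ spectrum ℝ T) (hy : y ∈ spectrum ℝ T) : ¬ x < y := by
    intro hxy
    -- Two functions with product zero, of which `f` is positive at `y` and `g` at `x`.
    set f : ℝ → ℝ := fun s => max (s - (x + y) / 2) 0 with hf
    set g : ℝ → ℝ := fun s => max ((x + y) / 2 - s) 0 with hg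
    have hfc : Continuous f := by fun_prop
    have hgc : Continuous g := by fun_prop
    have hfg : cfc f T * cfc g T = 0 := by
      rw [← cfc_mul f g T, show (fun s => f s * g s) = fun _ => 0 from ?_, cfc_const_zero]
      funext s
      rcases le_total s ((x + y) / 2) with h | h
      · simp [hf, h]
      · simp [hg, h]
    have hne (h : ℝ → ℝ) (hh : Continuous h) (z : ℝ) (hz : z ∈ spectrum ℝ T) (h0 : 0 < h z) :
        cfc h T ≠ 0 := by
      intro h'
      have h1 : h z ∈ spectrum ℝ (cfc h T) := by
        rw [cfc_map_spectrum h T]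
        exact ⟨z, hz, rfl⟩
      rw [h', spectrum.zero_eq] at h1
      exact h0.ne' h1
    rcases hρ.eq_zero_or_eq_zero (fun a => (hc a).cfc_real f) hfg with h | h
    · exact hne f hfc y hy (lt_max_of_lt_left (by linarith)) h
    · exact hne g hgc x hx (lt_max_of_lt_left (by linarith)) h
  refine ⟨c, ?_⟩
  rw [← cfc_const c T]
  conv_lhs => rw [← cfc_id' ℝ T]
  refine cfc_congr fun s hs => ?_
  exact le_antisymm (not_lt.1 (key c s hc' hs)) (not_lt.1 (key s c hs hc'))

/-- An irreducible representation `ρ` with a nonzero intertwiner `S` from `σ` is equivalent to a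
subrepresentation of `σ`: by Schur's lemma `S S^*` is a scalar, so a multiple of `S^*` is an
isometry. -/
theorem IsIrreducible.equivToSubrep {ρ : A →⋆ₐ[ℂ] (H →L[ℂ] H)} (hρ : IsIrreducible ρ)
    {σ : A →⋆ₐ[ℂ] (K →L[ℂ] K)} (S : K →L[ℂ] H) (hS : ∀ a, S ∘L σ a = ρ a ∘L S) (hS0 : S ≠ 0) :
    EquivToSubrep ρ σ := by
  set R : H →L[ℂ] K := ContinuousLinearMap.adjoint S with hR
  have hR' (a : A) : R ∘L ρ a = σ a ∘L R := by
    have h := congrArg ContinuousLinearMap.adjoint (hS (star a))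
    rw [ContinuousLinearMap.adjoint_comp, ContinuousLinearMap.adjoint_comp,
      ← ContinuousLinearMap.star_eq_adjoint (ρ _), ← ContinuousLinearMap.star_eq_adjoint (σ _),
      ← map_star, ← map_star, star_star] at h
    exact h.symm
  obtain ⟨c, hc⟩ := hρ.exists_eq_algebraMap (T := S ∘L R)
    (ContinuousLinearMap.isPositive_self_comp_adjoint S).isSelfAdjoint (fun a => by
      change (S ∘L R) ∘L ρ a = ρ a ∘L (S ∘L R)
      rw [ContinuousLinearMap.comp_assoc, hR', ← ContinuousLinearMap.comp_assoc, hS,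
        ContinuousLinearMap.comp_assoc])
  have hSR (v : H) : S (R v) = (c : ℂ) • v := by
    have h := congrArg (fun T : H →L[ℂ] H => T v) hc
    rw [Algebra.algebraMap_eq_smul_one] at h
    exact h
  have hnorm (v : H) : ‖R v‖ ^ 2 = c * ‖v‖ ^ 2 := by
    have h : inner ℂ (R v) (R v) = inner ℂ v ((c : ℂ) • v) := by
      rw [← hSR, hR, ContinuousLinearMap.adjoint_inner_left]
    rw [inner_smul_right, inner_self_eq_ofReal, inner_self_eq_ofReal] at h
    exact_mod_cast h
  have hcpos : 0 < c := by
    by_contra! hneg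
    apply hS0
    have hR0 : R = 0 := by
      ext v
      have h1 := hnorm v
      have h2 : c * ‖v‖ ^ 2 ≤ 0 := mul_nonpos_of_nonpos_of_nonneg hneg (sq_nonneg _)
      have h3 : ‖R v‖ = 0 := by nlinarith [sq_nonneg ‖R v‖]
      simpa using h3
    rw [← ContinuousLinearMap.adjoint_adjoint S, ← hR, hR0, map_zero]
  let J : H →ₗᵢ[ℂ] K :=
    { toLinearMap := (((√c)⁻¹ : ℝ) : ℂ) • (R : H →ₗ[ℂ] K)
      norm_map' := fun v => by
        change ‖(((√c)⁻¹ : ℝ) : ℂ) • R v‖ = ‖v‖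
        have hs := Real.sqrt_pos.2 hcpos
        have h1 : ‖R v‖ = √c * ‖v‖ := by
          rw [← Real.sqrt_sq (norm_nonneg (R v)), hnorm, Real.sqrt_mul hcpos.le,
            Real.sqrt_sq (norm_nonneg v)]
        rw [norm_smul, Complex.norm_real, Real.norm_of_nonneg (inv_nonneg.2 hs.le), h1,
          inv_mul_cancel_left₀ hs.ne'] }
  have hJ (a : A) (v : H) : J (ρ a v) = σ a (J v) := by
    change (((√c)⁻¹ : ℝ) : ℂ) • R (ρ a v) = σ a ((((√c)⁻¹ : ℝ) : ℂ) • R v)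
    rw [map_smul]
    congr 1
    exact congrArg (fun T : H →L[ℂ] K => T v) (hR' a)
  have hW (a : A) (v : K) (hv : v ∈ J.range) : σ a v ∈ J.range := by
    obtain ⟨w, rfl⟩ := hv
    exact ⟨ρ a w, hJ a w⟩
  have hred : IsReducing σ J.range := fun a => ⟨hW a, fun v hv w hw => by
    rw [← ContinuousLinearMap.adjoint_inner_left, ← ContinuousLinearMap.star_eq_adjoint,
      ← map_star]
    exact hv _ (hW (star a) w hw)⟩
  refine ⟨J.range, J.isometry.isUniformInducing.isComplete_range.completeSpace_coe, hred,
    J.equivRange, fun a v => Subtype.ext ?_⟩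
  exact hJ a v

end Schur

/-- Operators intertwining two representations of `C*(G)` on the generators intertwine them. -/
lemma CStarAlg.intertwine_of_p {U V : Type*} [Fintype U] [Fintype V] {G : BipartiteGraph U V}
    {H : Type*} [NormedAddCommGroup H] [InnerProductSpace ℂ H] [CompleteSpace H]
    {K : Type*} [NormedAddCommGroup K] [InnerProductSpace ℂ K] [CompleteSpace K]
    {ρ : CStarAlg G →⋆ₐ[ℂ] (H →L[ℂ] H)} {σ : CStarAlg G →⋆ₐ[ℂ] (K →L[ℂ] K)} {S : K →L[ℂ] H}
    (h : ∀ x, S ∘L σ (CStarAlg.p G x) = ρ (CStarAlg.p G x) ∘L S) (a : CStarAlg G) :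
    S ∘L σ a = ρ a ∘L S := by
  have hρ : Continuous ρ :=
    AddMonoidHomClass.continuous_of_bound ρ 1 fun a => by
      rw [one_mul]; exact NonUnitalStarAlgHom.norm_apply_le ρ a
  have hσ : Continuous σ :=
    AddMonoidHomClass.continuous_of_bound σ 1 fun a => by
      rw [one_mul]; exact NonUnitalStarAlgHom.norm_apply_le σ a
  induction a using CStarAlg.mk_induction with
  | hc => exact isClosed_eq (continuous_const.clm_comp hσ) (hρ.clm_comp continuous_const)
  | h a =>
    induction a using FreeStarAlg.gen_induction with
    | h1 => rw [CStarAlg.mk_one, map_one, map_one]; rfl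
    | hgen y a ih =>
      rw [CStarAlg.mk_mul, map_mul, map_mul]
      change S ∘L (σ (CStarAlg.p G y) ∘L σ (mk G a)) = (ρ (CStarAlg.p G y) ∘L ρ (mk G a)) ∘L S
      rw [← ContinuousLinearMap.comp_assoc, h, ContinuousLinearMap.comp_assoc, ih,
        ContinuousLinearMap.comp_assoc]
    | hsmul c a ih =>
      rw [CStarAlg.mk_smul, map_smul, map_smul, ContinuousLinearMap.comp_smul, ih,
        ContinuousLinearMap.smul_comp]
    | hadd a b iha ihb =>
      rw [CStarAlg.mk_add, map_add, map_add, ContinuousLinearMap.comp_add, iha, ihb,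
        ContinuousLinearMap.add_comp]

/-- Projections on a Hilbert space with sum `1` are mutually orthogonal: for `v` in the range of
one of them, `‖v‖ ^ 2` is the sum of the `‖P_i v‖ ^ 2`, and the term of that projection is `‖v‖ ^ 2`
already. -/
lemma mul_eq_zero_of_sum_eq_one {H : Type*} [NormedAddCommGroup H] [InnerProductSpace ℂ H]
    [CompleteSpace H] {ι : Type*} [Fintype ι] {P : ι → H →L[ℂ] H}
    (hP : ∀ i, IsStarProjection (P i)) (hsum : ∑ i, P i = 1) {i j : ι} (hij : i ≠ j) :
    P i * P j = 0 := by
  have hidem (k : ι) (v : H) : P k (P k v) = P k v :=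
    congrArg (fun T : H →L[ℂ] H => T v) (hP k).isIdempotentElem.eq
  have hinner (k : ι) (v : H) : inner ℂ (P k v) v = ((‖P k v‖ ^ 2 : ℝ) : ℂ) := by
    have hsa : ContinuousLinearMap.adjoint (P k) = P k := (hP k).isSelfAdjoint.star_eq
    rw [← hidem k v, ← ContinuousLinearMap.adjoint_inner_right, hsa, hidem,
      inner_self_eq_ofReal]
  ext v
  set w := P j v with hw
  have h1 : ∑ k, ‖P k w‖ ^ 2 = ‖w‖ ^ 2 := by
    have h2 : ∑ k, inner ℂ (P k w) w = inner ℂ w w := by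
      rw [← sum_inner, ← sum_apply, hsum, one_apply_eq_self]
    simp only [hinner] at h2
    rw [inner_self_eq_ofReal] at h2
    exact_mod_cast h2
  have hjw : P j w = w := hidem j v
  classical
  rw [← Finset.add_sum_erase _ _ (Finset.mem_univ j), hjw, add_eq_left,
    Finset.sum_eq_zero_iff_of_nonneg fun k _ => sq_nonneg _] at h1
  have := h1 i (Finset.mem_erase.2 ⟨hij, Finset.mem_univ i⟩)
  simpa using this

/-! ### The intertwiner from the model representation -/

section Model

variable {n : ℕ} {H : Type*} [NormedAddCommGroup H] [InnerProductSpace ℂ H] [CompleteSpace H]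

/-- A family of operators satisfying the relations of `C*(Q_n)` is a cube family. -/
lemma IsGraphFamily.isCubeFamily {p : EvenVertex n ⊕ OddVertex n → H →L[ℂ] H}
    (hp : IsGraphFamily (hypercube n) p) : IsCubeFamily p where
  toIsGraphFamily := hp
  orth_left _ _ h := mul_eq_zero_of_sum_eq_one (P := fun i => p (.inl i))
    (fun i => hp.proj (.inl i)) hp.sum_left h
  orth_right _ _ h := mul_eq_zero_of_sum_eq_one (P := fun j => p (.inr j))
    (fun j => hp.proj (.inr j)) hp.sum_right h

variable {p : EvenVertex n ⊕ OddVertex n → H →L[ℂ] H}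

/-- If every `M_k M_k^*` is the scalar `t_k`, then the operators `B_l = M_{k₀} M_l^*` have a common
eigenvector for the eigenvalues `√(t_{k₀} t_l)`. They commute and `B_l ^ 2 = t_{k₀} t_l`, so a
common eigenvector exists for some signs of the eigenvalues; the sign operator `Z_l`, which
anticommutes with `B_l` and commutes with the others, corrects the sign belonging to `l`. -/
lemma IsCubeFamily.exists_eigenvector [Nontrivial H] (hp : IsCubeFamily p) {t : Fin n → ℝ}
    (ht0 : ∀ k, 0 ≤ t k)
    (ht : ∀ k v, (edgeSum p k * star (edgeSum p k)) v = (t k : ℂ) • v) (k₀ : Fin n) :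
    ∃ y : H, y ≠ 0 ∧ ∀ l, (edgeSum p k₀ * star (edgeSum p l)) y
      = ((√(t k₀) * √(t l) : ℝ) : ℂ) • y := by
  set b : Fin n → H →L[ℂ] H := fun l => edgeSum p k₀ * star (edgeSum p l) with hb
  set c : Fin n → ℂ := fun l => ((√(t k₀) * √(t l) : ℝ) : ℂ) with hcdef
  have hsq (l : Fin n) : c l * c l = (t k₀ : ℂ) * (t l : ℂ) := by
    simp only [hcdef]
    have h1 := Real.mul_self_sqrt (ht0 k₀)
    have h2 := Real.mul_self_sqrt (ht0 l)
    have h3 : (√(t k₀) * √(t l)) * (√(t k₀) * √(t l)) = t k₀ * t l := by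
      calc _ = (√(t k₀) * √(t k₀)) * (√(t l) * √(t l)) := by ring
        _ = _ := by rw [h1, h2]
    exact_mod_cast h3
  have hmul (l m : Fin n) (v : H) :
      b l (b m v) = (t k₀ : ℂ) • (edgeSum p l * star (edgeSum p m)) v := by
    have e : b l * b m = edgeSum p k₀ * star (edgeSum p k₀) *
        (edgeSum p l * star (edgeSum p m)) := by
      simp only [hb]
      rw [mul_assoc, ← mul_assoc (star (edgeSum p l)), hp.star_edgeSum_mul_comm l k₀]
      simp only [mul_assoc]
    rw [← ht k₀]
    exact congrArg (fun T : H →L[ℂ] H => T v) e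
  have hself (l : Fin n) (v : H) : b l (b l v) = (c l * c l) • v := by
    rw [hmul, ht, smul_smul, hsq]
  have hcomm (l m : Fin n) (v : H) : b l (b m v) = b m (b l v) := by
    rw [hmul, hmul, hp.edgeSum_mul_star_comm]
  have hsign {l : Fin n} (hl : k₀ ≠ l) (m : Fin n) (v : H) :
      b m (digitSign p l v) = (if m = l then (-1 : ℤ) else 1) • digitSign p l (b m v) :=
    congrArg (fun T : H →L[ℂ] H => T v) (hp.edgeSum_mul_star_mul_digitSign hl m)
  have main (F : Finset (Fin n)) : ∃ y : H, y ≠ 0 ∧ ∀ l ∈ F, b l y = c l • y := by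
    induction F using Finset.induction_on with
    | empty =>
      obtain ⟨y, hy⟩ := exists_ne (0 : H)
      exact ⟨y, hy, by simp⟩
    | insert l F hl ih =>
      obtain ⟨y, hy, hF⟩ := ih
      rcases eq_or_ne k₀ l with rfl | hkl
      · refine ⟨y, hy, Finset.forall_mem_insert _ _ _ |>.2 ⟨?_, hF⟩⟩
        rw [hb, hcdef]
        simp only
        rw [ht, Real.mul_self_sqrt (ht0 _)]
      -- As `b_l ^ 2 = c_l ^ 2`, the vector `b_l y + c_l y` is an eigenvector for `c_l` unless it is
      -- zero; in that case `y` is one for `-c_l`, and `Z_l y` is one for `c_l`.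
      by_cases hy' : b l y + c l • y = 0
      · refine ⟨digitSign p l y, fun h => hy ?_, Finset.forall_mem_insert _ _ _ |>.2 ⟨?_, ?_⟩⟩
        · have h1 : digitSign p l (digitSign p l y) = y :=
            congrArg (fun T : H →L[ℂ] H => T y) (hp.digitSign_mul_self l)
          rw [← h1, h, map_zero]
        · rw [hsign hkl, if_pos rfl, eq_neg_of_add_eq_zero_left hy', map_neg, map_smul]
          simp
        · intro m hm
          rw [hsign hkl, if_neg (fun h : m = l => hl (h ▸ hm)), hF m hm, map_smul, one_smul]
      · refine ⟨_, hy', Finset.forall_mem_insert _ _ _ |>.2 ⟨?_, ?_⟩⟩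
        · rw [map_add, map_smul, hself, smul_add, smul_smul, add_comm]
        · intro m hm
          rw [map_add, map_smul, hcomm, hF m hm, map_smul, smul_add, smul_comm]
  obtain ⟨y, hy, h⟩ := main Finset.univ
  exact ⟨y, hy, fun l => h l (Finset.mem_univ l)⟩

/-- Vectors `y` and `z` exchanged by all `M_k` and `M_k^*` up to the factor `√t_k`; in the model
these are the sums of the basis vectors of the two vertex classes. -/
lemma IsCubeFamily.exists_pair [Nontrivial H] (hp : IsCubeFamily p) (t : stdSimplex ℝ (Fin n))
    (ht : ∀ k v, (edgeSum p k * star (edgeSum p k)) v = (t.1 k : ℂ) • v) :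
    ∃ y z : H, y ≠ 0 ∧ (∀ k, edgeSum p k z = (√(t.1 k) : ℂ) • y) ∧
      ∀ k, star (edgeSum p k) y = (√(t.1 k) : ℂ) • z := by
  obtain ⟨k₀, hk₀⟩ : ∃ k, t.1 k ≠ 0 := by
    by_contra! h
    have := t.2.2
    simp [h] at this
  have hpos : 0 < √(t.1 k₀) := Real.sqrt_pos.2 (lt_of_le_of_ne (t.2.1 k₀) hk₀.symm)
  have hne : (√(t.1 k₀) : ℂ) ≠ 0 := Complex.ofReal_ne_zero.2 hpos.ne'
  have hsq : (t.1 k₀ : ℂ) = (√(t.1 k₀) : ℂ) * (√(t.1 k₀) : ℂ) := by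
    exact_mod_cast (Real.mul_self_sqrt (t.2.1 k₀)).symm
  obtain ⟨y, hy, h⟩ := hp.exists_eigenvector t.2.1 ht k₀
  refine ⟨y, (√(t.1 k₀) : ℂ)⁻¹ • star (edgeSum p k₀) y, hy, fun k => ?_, fun k => ?_⟩
  · have h1 : edgeSum p k (star (edgeSum p k₀) y)
        = ((√(t.1 k₀) * √(t.1 k) : ℝ) : ℂ) • y := by
      rw [← h k, hp.edgeSum_mul_star_comm]
      rfl
    rw [map_smul, h1, smul_smul, Complex.ofReal_mul, inv_mul_cancel_left₀ hne]
  · have h1 : (t.1 k₀ : ℂ) • star (edgeSum p k) y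
        = ((√(t.1 k₀) * √(t.1 k) : ℝ) : ℂ) • star (edgeSum p k₀) y := by
      rw [← ht k₀, ← map_smul, ← h k, hp.edgeSum_mul_star_self]
      rfl
    have h2 : (t.1 k₀ : ℂ) ≠ 0 := Complex.ofReal_ne_zero.2 hk₀
    rw [← inv_smul_smul₀ h2 (star (edgeSum p k) y), h1, smul_smul, smul_smul, hsq]
    congr 1
    push_cast
    field_simp

/-- The vectors `x_i = p_i y` transform under the `p_j` as the basis vectors of the model do. -/
lemma IsCubeFamily.right_apply (hp : IsCubeFamily p) (t : stdSimplex ℝ (Fin n)) {y z : H}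
    (hz : ∀ k, edgeSum p k z = (√(t.1 k) : ℂ) • y)
    (hy : ∀ k, star (edgeSum p k) y = (√(t.1 k) : ℂ) • z) (i : EvenVertex n) (j : OddVertex n) :
    p (.inr j) (p (.inl i) y) = star ((simplexWeighting t).toFun i j) •
      ∑ i', (simplexWeighting t).toFun i' j • p (.inl i') y := by
  have hsum : ∑ i', (simplexWeighting t).toFun i' j • p (.inl i') y = p (.inr j) z := by
    rw [← one_apply_eq_self (F := H →L[ℂ] H) (p (.inr j) z), ← hp.sum_left, sum_apply]
    refine Finset.sum_congr rfl fun i' _ => ?_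
    by_cases h : (hypercube n).Adj i' j
    · obtain ⟨k, rfl⟩ := adj_iff_exists_nbr.1 h
      rw [simplexWeighting_apply t i' _ k rfl]
      have h1 := congrArg (fun T : H →L[ℂ] H => T z) (hp.left_mul_edgeSum i' k)
      change p (.inl i') (edgeSum p k z) = parSign k i'.1 • p (.inl i') (p (.inr (i'.nbr k)) z)
        at h1
      rw [hz, map_smul] at h1
      have h2 := congrArg (fun v => parSign k i'.1 • v) h1
      simp only [smul_smul, parSign_mul_self, one_smul] at h2
      rw [← h2, ← Int.cast_smul_eq_zsmul ℂ, smul_smul]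
      simp [parSign]
    · rw [(simplexWeighting t).zero_off _ _ h, zero_smul]
      exact (congrArg (fun T : H →L[ℂ] H => T z) (hp.orth i' j h)).symm
  rw [hsum]
  by_cases h : (hypercube n).Adj i j
  · obtain ⟨k, rfl⟩ := adj_iff_exists_nbr.1 h
    rw [simplexWeighting_apply t i _ k rfl]
    have h1 := congrArg (fun T : H →L[ℂ] H => T y) (hp.right_mul_star_edgeSum (i.nbr k) k)
    rw [i.nbr_nbr] at h1
    change p (.inr (i.nbr k)) (star (edgeSum p k) y)
      = parSign k i.1 • p (.inr (i.nbr k)) (p (.inl i) y) at h1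
    rw [hy, map_smul] at h1
    have h2 := congrArg (fun v => parSign k i.1 • v) h1
    simp only [smul_smul, parSign_mul_self, one_smul] at h2
    rw [← h2, ← Int.cast_smul_eq_zsmul ℂ, smul_smul]
    simp [parSign]
  · rw [(simplexWeighting t).zero_off _ _ h, star_zero, zero_smul]
    exact congrArg (fun T : H →L[ℂ] H => T y) (hp.orth' h)

/-- If `M_k M_k^*` is the scalar `t_k` for all `k`, then there is a nonzero intertwiner from `ρ_t`,
sending the basis vector with index `i` to `p_i y`. -/
theorem exists_intertwiner [Nontrivial H] (ρ : CStarAlg (hypercube n) →⋆ₐ[ℂ] (H →L[ℂ] H))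
    (t : stdSimplex ℝ (Fin n))
    (ht : ∀ k v, (edgeSum (fun x => ρ (CStarAlg.p (hypercube n) x)) k *
      star (edgeSum (fun x => ρ (CStarAlg.p (hypercube n) x)) k)) v = (t.1 k : ℂ) • v) :
    ∃ S : EuclideanSpace ℂ (EvenVertex n) →L[ℂ] H, S ≠ 0 ∧ ∀ a, S ∘L rhoT t a = ρ a ∘L S := by
  set p : EvenVertex n ⊕ OddVertex n → H →L[ℂ] H :=
    fun x => ρ (CStarAlg.p (hypercube n) x)
  have hp : IsCubeFamily p :=
    (EdgeWeighting.isGraphFamily_map (CStarAlg.isGraphFamily_p (hypercube n)) ρ).isCubeFamily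
  obtain ⟨y, z, hy0, hz, hy⟩ := hp.exists_pair t ht
  let S : EuclideanSpace ℂ (EvenVertex n) →L[ℂ] H :=
    ∑ i, (EuclideanSpace.proj i : EuclideanSpace ℂ (EvenVertex n) →L[ℂ] ℂ).smulRight (p (.inl i) y)
  have hS (v : EuclideanSpace ℂ (EvenVertex n)) : S v = ∑ i, v i • p (.inl i) y := by
    simp only [S, sum_apply]
    rfl
  refine ⟨S, fun h0 => hy0 ?_, CStarAlg.intertwine_of_p fun x => ?_⟩
  -- `S` maps the sum of all basis vectors to `y`.
  · have h1 : S (WithLp.toLp 2 fun _ => 1) = y := by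
      rw [hS]
      simp only [one_smul]
      rw [← sum_apply, hp.sum_left, one_apply_eq_self]
    rw [← h1, h0]
    rfl
  · ext v
    change S (rhoT t (CStarAlg.p (hypercube n) x) v) = p x (S v)
    rw [hS, hS, map_sum]
    rcases x with i | j
    · refine Finset.sum_congr rfl fun a _ => ?_
      rw [map_smul, rhoT_even, Matrix.ofLp_toEuclideanCLM, Matrix.single_mulVec]
      by_cases h : a = i
      · subst h
        have := congrArg (fun T : H →L[ℂ] H => T y) (hp.mul_self (.inl a))
        change p _ (p _ y) = _ at this
        simp [this]
      · have := congrArg (fun T : H →L[ℂ] H => T y) (hp.orth_left i a (Ne.symm h))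
        change p _ (p _ y) = 0 at this
        simp [this, h]
    · simp only [map_smul, hp.right_apply t hz hy, rhoT_odd, Matrix.ofLp_toEuclideanCLM,
        Matrix.mulVec, dotProduct, Matrix.of_apply, Finset.smul_sum, Finset.sum_smul, smul_smul]
      rw [Finset.sum_comm]
      refine Finset.sum_congr rfl fun b _ => Finset.sum_congr rfl fun a _ => ?_
      congr 1
      ring

end Model

end HypercubeAlgebra

theorem mainTheorem4 (n : ℕ) (hn : 1 ≤ n)
    {H : Type*} [NormedAddCommGroup H] [InnerProductSpace ℂ H] [CompleteSpace H]
    (ρ : HypercubeAlgebra.CStarAlg (HypercubeAlgebra.hypercube n) →⋆ₐ[ℂ] (H →L[ℂ] H))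
    (hρ : HypercubeAlgebra.IsIrreducible ρ) :
    ∃ t : stdSimplex ℝ (Fin n),
      HypercubeAlgebra.EquivToSubrep ρ (HypercubeAlgebra.rhoT t) := by
  open HypercubeAlgebra in
  have := hρ.1
  set p : EvenVertex n ⊕ OddVertex n → H →L[ℂ] H :=
    fun x => ρ (CStarAlg.p (hypercube n) x)
  have hp : IsCubeFamily p :=
    (EdgeWeighting.isGraphFamily_map (CStarAlg.isGraphFamily_p (hypercube n)) ρ).isCubeFamily
  have hscalar (k : Fin n) : ∃ c : ℝ,
      edgeSum p k * star (edgeSum p k) = algebraMap ℝ (H →L[ℂ] H) c :=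
    hρ.exists_eq_algebraMap (IsSelfAdjoint.mul_star_self _) fun a =>
      CStarAlg.intertwine_of_p (fun x => (hp.commute_edgeSum_mul_star x k).symm.eq) a
  choose t ht using hscalar
  have ht' (k : Fin n) (v : H) : (edgeSum p k * star (edgeSum p k)) v = (t k : ℂ) • v := by
    rw [ht, Algebra.algebraMap_eq_smul_one]
    rfl
  have hnonneg (k : Fin n) : 0 ≤ t k := by
    obtain ⟨v, hv⟩ := exists_ne (0 : H)
    have h1 : (inner ℂ v ((edgeSum p k * star (edgeSum p k)) v) : ℂ)
        = ((‖star (edgeSum p k) v‖ ^ 2 : ℝ) : ℂ) := by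
      rw [← inner_self_eq_ofReal]
      exact (ContinuousLinearMap.adjoint_inner_left (edgeSum p k) _ v).symm
    rw [ht', inner_smul_right, inner_self_eq_ofReal] at h1
    have h2 : t k * ‖v‖ ^ 2 = ‖star (edgeSum p k) v‖ ^ 2 := by exact_mod_cast h1
    have h3 : 0 < ‖v‖ ^ 2 := by positivity
    exact nonneg_of_mul_nonneg_left (h2 ▸ sq_nonneg _) h3
  have hsum : ∑ k, t k = 1 := by
    have h := hp.sum_edgeSum_mul_star
    simp only [ht] at h
    rw [← map_sum, ← map_one (algebraMap ℝ (H →L[ℂ] H))] at h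
    exact (algebraMap ℝ (H →L[ℂ] H)).injective h
  obtain ⟨S, hS0, hS⟩ := exists_intertwiner ρ ⟨t, hnonneg, hsum⟩ ht'
  exact ⟨⟨t, hnonneg, hsum⟩, hρ.equivToSubrep S hS hS0⟩
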